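/- **Setting.** Let $d,T\ge 1$, and let $\mathcal K\subset\mathbb R^d$ be closed, convex and centrally symmetric, containing the Euclidean unit ball, with $\|x-y\|\le D$ for all $x,y\in\mathcal K$. Let $f_1,\dots,f_T:\mathcal K\to[-1,1]$ be measurable functions, fixed in advance, that form a *$C$-approximately linear* sequence: there are $\theta_1,\dots,\theta_T\in\mathbb R^d$ with $\|\theta_t\|\le G$ and $$\sup_{x_1,\dots,x_T\in\mathcal K}\ \sum_{t=1}^T |f_t(x_t)-\theta_t^\top x_t|\le C .$$ Let $\nu>0$ and let $\mathcal R:\operatorname{int}\mathcal K\to\mathbb R$ be a $\nu$-self-concordant barrier on $\mathcal K$: $\mathcal R$ is $C^3$ and convex, tends to $+\infty$ at the boundary of $\mathcal K$, and for all $x\in\operatorname{int}\mathcal K$, $h\in\mathbb R^d$ satisfies $|D^3\mathcal R(x)[h,h,h]|\le 2\|h\|_x^3$ and $|\nabla \mathcal R(x)^\top h|\le\sqrt\nu\,\|h\|_x$, where $\|h\|_x=\sqrt{h^\top\nabla^2\mathcal R(x)h}$. For $\delta\in(0,1)$ put $\mathcal K_\delta=\{x:\tfrac1{1-\delta}x\in\mathcal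 K\}$. **Algorithm (SCRiBLe on $\mathcal K_\delta$, with learning rate $\eta$).** Start from $x_1\in\arg\min_{x\in\mathcal K_\delta}\mathcal R(x)$. In round $t=1,\dots,T$ let $A_t=[\nabla^2\mathcal R(x_t)]^{-1/2}$, draw $\mu_t$ uniformly from the unit sphere of $\mathbb R^d$, independently of the past, play $y_t=x_t+A_t\mu_t$, observe $f_t(y_t)$, set $g_t=d\,f_t(y_t)A_t^{-1}\mu_t$, and let $x_{t+1}\in\arg\min_{x\in\mathcal K_\delta}\{\eta\sum_{\tau\le t}g_\tau^\top x+\mathcal R(x)\}$. **Theorem.** For every $\delta\in(0,1)$, the algorithm with $\eta=\dfrac{\sqrt{\nu\ln(1/\delta)}}{2d\sqrt T}$ always plays points $y_t\in\mathcal K$, its regret is an integrable random variable, and $$\mathbb E\Big[\sum_{t=1}^T f_t(y_t)-\inf_{x\in\mathcal K}\sum_{t=1}^T f_t(x)\Big]\le 4d\sqrt{\nu T\ln\tfrac1\delta}+2Cd(\nu+2\sqrt\nu)\frac{1-\delta}{\delta}+\delta GDT+2C .$$ In particular, there is a number $c=c(\nu,G,D)$, depending on nothing else, such that, whenever $C/T\le\frac23$,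 the following hold with this $\eta$. If $C\ne0$ and $\delta=\sqrt{C/T}$, then the expected regret is at most $$c\,\sqrt{\ln (T/C)}\;\big(d\sqrt T+d\sqrt{TC}+dC\big).$$ If $C=0$, $T\ge2$ and $\delta=1/T^2$, then it is at most $c\,\sqrt{\ln T}\;d\sqrt T$. That is, the expected regret is $\widetilde O(d\sqrt T+d\sqrt{TC}+dC)$, where $\widetilde O$ hides the factor $c$ and the logarithmic factor. -/

import Mathlib

open MeasureTheory ProbabilityTheory Filter Topology Set
open scoped InnerProductSpace

universe u

noncomputable section

/-- Euclidean space `ℝ^d`. -/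
abbrev Euc (d : ℕ) : Type := EuclideanSpace ℝ (Fin d)

/-! ### The action set and the losses -/

/-- The standing assumptions on the action set: closed, convex, centrally symmetric, of diameter
at most `D` (hence bounded), and containing the unit ball. -/
structure IsActionSet {d : ℕ} (K : Set (Euc d)) (D : ℝ) : Prop where
  isClosed : IsClosed K
  convex : Convex ℝ K
  symm : ∀ x ∈ K, -x ∈ K
  diam_le : ∀ x ∈ K, ∀ y ∈ K, ‖x - y‖ ≤ D
  unitBall_subset : Metric.closedBall (0 : Euc d) 1 ⊆ K

/-- The shrunk set `K_δ = {x | (1/(1-δ)) x ∈ K}`. -/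
def shrunk {d : ℕ} (K : Set (Euc d)) (δ : ℝ) : Set (Euc d) :=
  {x | (1 / (1 - δ)) • x ∈ K}

/-- The total deviation of `f_1, …, f_T` from the linear functions `θ_1, …, θ_T` is at most `C`:
`sup_{x_1, …, x_T ∈ K} ∑_t |f_t(x_t) - θ_tᵀ x_t| ≤ C`. -/
def IsApproxLinearWith {d T : ℕ} (K : Set (Euc d)) (C : ℝ) (θ : Fin T → Euc d)
    (f : Fin T → Euc d → ℝ) : Prop :=
  ∀ x : Fin T → Euc d, (∀ t, x t ∈ K) → ∑ t, |f t (x t) - ⟪θ t, x t⟫_ℝ| ≤ C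

/-- The loss sequences that the (oblivious) adversary may choose: functions on `K` (the values
outside `K` play no role), measurable, bounded by `1` in absolute value, and forming a
`C`-approximately linear sequence whose linear parts have norm at most `G`. -/
structure IsLossSequence {d T : ℕ} (K : Set (Euc d)) (G C : ℝ) (f : Fin T → Euc d → ℝ) :
    Prop where
  measurable : ∀ t, Measurable (K.domRestrict (f t))
  abs_le_one : ∀ t, ∀ x ∈ K, |f t x| ≤ 1
  approxLinear : ∃ θ : Fin T → Euc d, (∀ t, ‖θ t‖ ≤ G) ∧ IsApproxLinearWith K C θ f

/-! ### Self-concordant barriers -/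

/-- The local norm `‖h‖_x = √(hᵀ ∇²R(x) h)`. -/
def localNorm {d : ℕ} (R : Euc d → ℝ) (x h : Euc d) : ℝ :=
  √(iteratedFDeriv ℝ 2 R x (fun _ => h))

/-- `R` is a `ν`-self-concordant barrier on `K` (only its values on the interior matter). -/
structure IsSelfConcordantBarrier {d : ℕ} (K : Set (Euc d)) (R : Euc d → ℝ) (ν : ℝ) :
    Prop where
  contDiffOn : ContDiffOn ℝ 3 R (interior K)
  convexOn : ConvexOn ℝ (interior K) R
  tendsto_atTop : ∀ z ∈ frontier K, Tendsto R (𝓝[interior K] z) atTop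
  third_le : ∀ x ∈ interior K, ∀ h : Euc d,
    |iteratedFDeriv ℝ 3 R x (fun _ => h)| ≤ 2 * localNorm R x h ^ 3
  grad_le : ∀ x ∈ interior K, ∀ h : Euc d, |fderiv ℝ R x h| ≤ √ν * localNorm R x h

/-- The Hessian matrix `∇²R(x)`. -/
def hessian {d : ℕ} (R : Euc d → ℝ) (x : Euc d) : Matrix (Fin d) (Fin d) ℝ :=
  Matrix.of fun i j =>
    iteratedFDeriv ℝ 2 R x ![EuclideanSpace.single i 1, EuclideanSpace.single j 1]

/-- The matrix `[∇²R(x)]^{-1/2}`, through the functional calculus of symmetric matrices. -/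
def invSqrtHessian {d : ℕ} (R : Euc d → ℝ) (x : Euc d) : Matrix (Fin d) (Fin d) ℝ :=
  cfc (fun s : ℝ => s ^ (-(1 / 2) : ℝ)) (hessian R x)

/-! ### The algorithm -/

/-- The uniform probability measure on the unit sphere of `ℝ^d`: the normalized surface
measure. -/
def uniformSphere (d : ℕ) : Measure (Metric.sphere (0 : Euc d) 1) :=
  ((volume : Measure (Euc d)).toSphere univ)⁻¹ • (volume : Measure (Euc d)).toSphere

/-- The point `y = x + A u`, with `A = [∇²R(x)]^{-1/2}`, that is played at the iterate `x` when
the direction `u` is drawn. -/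
def playedPoint {d : ℕ} (R : Euc d → ℝ) (x : Euc d) (u : Metric.sphere (0 : Euc d) 1) : Euc d :=
  x + Matrix.toEuclideanLin (invSqrtHessian R x) (u : Euc d)

/-- The estimator `g = d ℓ A⁻¹ u`, with `A = [∇²R(x)]^{-1/2}`, computed at the iterate `x` from
the direction `u` and the observed loss `ℓ`. -/
def gradEstimate {d : ℕ} (R : Euc d → ℝ) (x : Euc d) (u : Metric.sphere (0 : Euc d) 1)
    (l : ℝ) : Euc d :=
  ((d : ℝ) * l) • Matrix.toEuclideanLin (invSqrtHessian R x)⁻¹ (u : Euc d)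

/-- The point played in round `t`. -/
def scribblePlay {d T : ℕ} {Ω : Type u} (R : Euc d → ℝ)
    (U : Fin T → Ω → Metric.sphere (0 : Euc d) 1) (x : Fin T → Ω → Euc d)
    (t : Fin T) (ω : Ω) : Euc d :=
  playedPoint R (x t ω) (U t ω)

/-- The estimator formed in round `t`, from the observed loss `f_t(y_t)` only. -/
def scribbleGrad {d T : ℕ} {Ω : Type u} (R : Euc d → ℝ) (f : Fin T → Euc d → ℝ)
    (U : Fin T → Ω → Metric.sphere (0 : Euc d) 1) (x : Fin T → Ω → Euc d)
    (t : Fin T) (ω : Ω) : Euc d :=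
  gradEstimate R (x t ω) (U t ω) (f t (scribblePlay R U x t ω))

/-- A run of SCRiBLe over `T` rounds with iterates in the shrunk set `K_δ` and learning rate `η`:
the directions `U t` are independent and uniform on the sphere, and each iterate `x t` minimizes
`z ↦ η ∑_{τ < t} g_τᵀ z + R z` over `K_δ` (in the first round the sum is empty, so that `x` is
then a minimizer of `R`). -/
structure IsScribbleRun {d T : ℕ} {Ω : Type u} [MeasurableSpace Ω] (P : Measure Ω)
    (K : Set (Euc d)) (R : Euc d → ℝ) (η δ : ℝ) (f : Fin T → Euc d → ℝ)
    (U : Fin T → Ω → Metric.sphere (0 : Euc d) 1) (x : Fin T → Ω → Euc d) : Prop where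
  measurable_dir : ∀ t, Measurable (U t)
  indep_dir : iIndepFun U P
  law_dir : ∀ t, P.map (U t) = uniformSphere d
  mem_shrunk : ∀ t ω, x t ω ∈ shrunk K δ
  isMinOn : ∀ t ω,
    IsMinOn (fun z => η * ∑ τ ∈ Finset.Iio t, ⟪scribbleGrad R f U x τ ω, z⟫_ℝ + R z)
      (shrunk K δ) (x t ω)

/-- The learning rate `η = √(ν ln(1/δ)) / (2 d √T)`. -/
def learningRate (d T : ℕ) (ν δ : ℝ) : ℝ :=
  √(ν * Real.log (1 / δ)) / (2 * d * √(T : ℝ))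

/-- The regret `∑_t f_t(y_t) - inf_{x ∈ K} ∑_t f_t(x)` of the plays `y_t`. -/
def regret {d T : ℕ} (K : Set (Euc d)) (f : Fin T → Euc d → ℝ) (y : Fin T → Euc d) : ℝ :=
  ∑ t, f t (y t) - ⨅ z : K, ∑ t, f t z

end

/-!
The proof follows the classical analysis of SCRiBLe, with the deviation from linearity carried along.

*Self-concordant barriers.* Along a line, `ψ(t) = D²R(x + t h)[h, h]` satisfies
`|ψ'| ≤ 2 ψ^{3/2}`, so that `ψ^{-1/2}` is `1`-Lipschitz
(`IsSelfConcordantBarrier.abs_localNorm_sub_le`). This comparison of local norms gives the Dikin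
ellipsoid, hence `y_t ∈ K` and the nondegeneracy of the Hessian (`add_mem`, `localNorm_pos`), and the
strong monotonicity of the gradient (`le_fderiv_sub`). With the gradient bound it gives the
logarithmic growth of the barrier (`sub_le_log`) and a bound `ν + 2√ν` on local distances in the
half space where the linearization grows (`localNorm_sub_le`). In the shrunk body, by central
symmetry, local distances are at most `ρ = 2 (ν + 2√ν) (1 - δ) / δ`.

*Regularized leaders.* The iterates are unique minimizers, and continuous functions of the sum of
the estimators (`exists_leader`). If `η d ≤ 1/2`, then the regret against the estimated linear losses
is at most `2 η d² T + (R(y) - min R) / η` (`leader_regret`). The comparator is not `(1 - δ) z` but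
`y = (1 - δ)² z`: it costs at most `δ G D` per round, as `‖z‖ ≤ D / 2`, and its barrier value exceeds
the minimum over the shrunk body by at most `ν ln (1/δ)`, without a further constant
(`sub_le_log_of_mem_shrunk`). If `η d > 1/2`, then the claimed bound exceeds the trivial one, `2 T`.

*Expectation.* The iterate of a round is measurable with respect to the earlier directions, which are
independent of the current one. The uniform distribution on the sphere has mean zero and covariance
`1/d`, so the estimator is unbiased but for the deviation `f_t(y_t) - θ_tᵀ y_t`, which enters with a
factor of at most `1 + d ρ` (`IsScribbleRun.integral_loss_eq`). As the deviations of a single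
trajectory sum to at most `C`, this adds at most `C (1 + d ρ)`; comparing `f_t` with its linear part
at the comparator adds another `C`.
-/

/-! ### Calculus along lines -/

/-- Along a line, the derivative of the `n`-th directional derivative is the `(n+1)`-st. -/
theorem hasDerivAt_iteratedFDeriv_line {E : Type*} [NormedAddCommGroup E] [NormedSpace ℝ E]
    {R : E → ℝ} {n : ℕ} {x h : E} {t : ℝ} (hR : ContDiffAt ℝ (n + 1 : ℕ) R (x + t • h)) :
    HasDerivAt (fun s : ℝ => iteratedFDeriv ℝ n R (x + s • h) (fun _ => h))
      (iteratedFDeriv ℝ (n + 1) R (x + t • h) (fun _ => h)) t := by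
  have hd : DifferentiableAt ℝ (iteratedFDeriv ℝ n R) (x + t • h) :=
    hR.differentiableAt_iteratedFDeriv (by exact_mod_cast Nat.lt_succ_self n)
  have hline : HasDerivAt (fun s : ℝ => x + s • h) h t := by
    simpa using ((hasDerivAt_id t).smul_const h).const_add x
  have h1 := hd.hasFDerivAt.comp_hasDerivAt t hline
  have h2 := ((ContinuousMultilinearMap.apply ℝ (fun _ : Fin n => E) ℝ
    (fun _ => h)).hasFDerivAt).comp_hasDerivAt t h1
  exact h2

theorem hasDerivAt_fderiv_line {E : Type*} [NormedAddCommGroup E] [NormedSpace ℝ E]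
    {R : E → ℝ} {x h : E} {t : ℝ} (hR : ContDiffAt ℝ 2 R (x + t • h)) :
    HasDerivAt (fun s : ℝ => fderiv ℝ R (x + s • h) h)
      (iteratedFDeriv ℝ 2 R (x + t • h) (fun _ => h)) t := by
  have := hasDerivAt_iteratedFDeriv_line (n := 1) (x := x) (h := h) (t := t) (R := R)
    (by exact_mod_cast hR)
  simpa [iteratedFDeriv_one_apply] using this

theorem hasDerivAt_line {E : Type*} [NormedAddCommGroup E] [NormedSpace ℝ E]
    {R : E → ℝ} {x h : E} {t : ℝ} (hR : DifferentiableAt ℝ R (x + t • h)) :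
    HasDerivAt (fun s : ℝ => R (x + s • h)) (fderiv ℝ R (x + t • h) h) t := by
  have hline : HasDerivAt (fun s : ℝ => x + s • h) h t := by
    simpa using ((hasDerivAt_id t).smul_const h).const_add x
  exact hR.hasFDerivAt.comp_hasDerivAt t hline

/-- A differentiable function whose derivative is nonnegative on `[a, b]` does not decrease. -/
theorem le_of_hasDerivAt_nonneg {g g' : ℝ → ℝ} {a b : ℝ} (hab : a ≤ b)
    (hd : ∀ t ∈ Icc a b, HasDerivAt g (g' t) t) (h0 : ∀ t ∈ Icc a b, 0 ≤ g' t) : g a ≤ g b := by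
  have hm : MonotoneOn g (Icc a b) := by
    refine monotoneOn_of_hasDerivWithinAt_nonneg (f' := g') (convex_Icc a b)
      (fun t ht => (hd t ht).continuousAt.continuousWithinAt)
      (fun t ht => (hd t (interior_subset ht)).hasDerivWithinAt)
      (fun t ht => h0 t (interior_subset ht))
  exact hm (left_mem_Icc.2 hab) (right_mem_Icc.2 hab) hab

/-! ### Self-concordant barriers -/

namespace IsSelfConcordantBarrier

variable {d : ℕ} {K : Set (Euc d)} {R : Euc d → ℝ} {ν D : ℝ}

theorem contDiffAt (hR : IsSelfConcordantBarrier K R ν) {x : Euc d} (hx : x ∈ interior K) :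
    ContDiffAt ℝ 3 R x :=
  hR.contDiffOn.contDiffAt (isOpen_interior.mem_nhds hx)

theorem differentiableAt (hR : IsSelfConcordantBarrier K R ν) {x : Euc d}
    (hx : x ∈ interior K) : DifferentiableAt ℝ R x :=
  (hR.contDiffAt hx).differentiableAt (by norm_num)

theorem second_nonneg (hR : IsSelfConcordantBarrier K R ν) {x : Euc d} (hx : x ∈ interior K)
    (h : Euc d) : 0 ≤ iteratedFDeriv ℝ 2 R x (fun _ => h) := by
  set L : ℝ →ᵃ[ℝ] Euc d := AffineMap.lineMap x (x + h) with hL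
  have hLt : ∀ t, L t = x + t • h := fun t => by
    simp [hL, AffineMap.lineMap_apply, add_comm]
  set S : Set ℝ := L ⁻¹' interior K with hS
  have hSo : IsOpen S := isOpen_interior.preimage (by
    have : (L : ℝ → Euc d) = fun t => x + t • h := funext hLt
    rw [this]; fun_prop)
  have h0 : (0 : ℝ) ∈ S := by simpa [hS, hLt] using hx
  have hconv : ConvexOn ℝ S (R ∘ L) := hR.convexOn.comp_affineMap L
  have hRL : (R ∘ L) = fun t : ℝ => R (x + t • h) := funext fun t => by simp [hLt]
  have hmemS : ∀ t ∈ S, x + t • h ∈ interior K := fun t ht => by rw [← hLt]; exact ht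
  have hmono := hconv.monotoneOn_deriv (fun t ht => by
    rw [hRL]
    exact (hasDerivAt_line (hR.differentiableAt (hmemS t ht))).differentiableAt)
  have hder : ∀ t ∈ S, deriv (R ∘ L) t = fderiv ℝ R (x + t • h) h := fun t ht => by
    rw [hRL]
    exact (hasDerivAt_line (hR.differentiableAt (hmemS t ht))).deriv
  have hm2 : MonotoneOn (fun t : ℝ => fderiv ℝ R (x + t • h) h) S :=
    fun a ha b hb hab => by
      have := hmono ha hb hab
      rwa [hder a ha, hder b hb] at this
  have hd : HasDerivAt (fun t : ℝ => fderiv ℝ R (x + t • h) h)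
      (iteratedFDeriv ℝ 2 R (x + (0 : ℝ) • h) (fun _ => h)) 0 :=
    hasDerivAt_fderiv_line ((hR.contDiffAt (hmemS 0 h0)).of_le (by norm_num))
  have h1 := hm2.derivWithin_nonneg (x := 0)
  rw [hd.hasDerivWithinAt.derivWithin (hSo.uniqueDiffWithinAt h0)] at h1
  simpa using h1

theorem localNorm_sq (hR : IsSelfConcordantBarrier K R ν) {x : Euc d} (hx : x ∈ interior K)
    (h : Euc d) : localNorm R x h ^ 2 = iteratedFDeriv ℝ 2 R x (fun _ => h) :=
  Real.sq_sqrt (hR.second_nonneg hx h)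

end IsSelfConcordantBarrier

theorem localNorm_nonneg {d : ℕ} (R : Euc d → ℝ) (x h : Euc d) : 0 ≤ localNorm R x h :=
  Real.sqrt_nonneg _

theorem localNorm_smul {d : ℕ} (R : Euc d → ℝ) (x h : Euc d) (c : ℝ) :
    localNorm R x (c • h) = |c| * localNorm R x h := by
  unfold localNorm
  have : iteratedFDeriv ℝ 2 R x (fun _ => c • h) = c ^ 2 * iteratedFDeriv ℝ 2 R x (fun _ => h) := by
    have := (iteratedFDeriv ℝ 2 R x).map_smul_univ (fun _ => c) (fun _ => h)
    simpa [pow_two] using this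
  rw [this, Real.sqrt_mul (sq_nonneg c), Real.sqrt_sq_eq_abs]

namespace IsSelfConcordantBarrier

variable {d : ℕ} {K : Set (Euc d)} {R : Euc d → ℝ} {ν D : ℝ}

/-- Self-concordance in integrated form: the local norms of `h` at `x` and at `x + h` satisfy
`|1/a - 1/b| ≤ 1`, written without denominators so that it also covers `a = 0` or `b = 0`. -/
theorem abs_localNorm_sub_le (hR : IsSelfConcordantBarrier K R ν) {x h : Euc d}
    (hseg : ∀ t ∈ Icc (0 : ℝ) 1, x + t • h ∈ interior K) :
    |localNorm R x h - localNorm R (x + h) h| ≤ localNorm R x h * localNorm R (x + h) h := by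
  set ψ : ℝ → ℝ := fun t => iteratedFDeriv ℝ 2 R (x + t • h) (fun _ => h) with hψ
  have hψ0 : ∀ t ∈ Icc (0 : ℝ) 1, 0 ≤ ψ t := fun t ht => hR.second_nonneg (hseg t ht) h
  have hψd : ∀ t ∈ Icc (0 : ℝ) 1,
      HasDerivAt ψ (iteratedFDeriv ℝ 3 R (x + t • h) (fun _ => h)) t := fun t ht =>
    hasDerivAt_iteratedFDeriv_line (n := 2) (hR.contDiffAt (hseg t ht))
  -- `(ψ + ε)^{-1/2}` is `1`-Lipschitz for every `ε > 0`, also where `ψ` vanishes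
  have key : ∀ ε : ℝ, 0 < ε →
      |√(ψ 0 + ε) - √(ψ 1 + ε)| ≤ √(ψ 0 + ε) * √(ψ 1 + ε) := by
    intro ε hε
    have hpos : ∀ t ∈ Icc (0 : ℝ) 1, 0 < √(ψ t + ε) := fun t ht =>
      Real.sqrt_pos.2 (by linarith [hψ0 t ht])
    have hv : ∀ t ∈ Icc (0 : ℝ) 1, HasDerivWithinAt (fun t => (√(ψ t + ε))⁻¹)
        (-(iteratedFDeriv ℝ 3 R (x + t • h) (fun _ => h) / (2 * √(ψ t + ε))) /
          √(ψ t + ε) ^ 2) (Icc 0 1) t := fun t ht => by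
      have h1 := ((hψd t ht).add_const ε).sqrt (by linarith [hψ0 t ht])
      exact (h1.inv (hpos t ht).ne').hasDerivWithinAt
    have hb : ∀ t ∈ Icc (0 : ℝ) 1,
        ‖-(iteratedFDeriv ℝ 3 R (x + t • h) (fun _ => h) / (2 * √(ψ t + ε))) /
          √(ψ t + ε) ^ 2‖ ≤ 1 := fun t ht => by
      have hs := hpos t ht
      have h3 := hR.third_le _ (hseg t ht) h
      have hle : localNorm R (x + t • h) h ≤ √(ψ t + ε) :=
        Real.sqrt_le_sqrt (by simp only [hψ]; linarith)
      have h4 : localNorm R (x + t • h) h ^ 3 ≤ √(ψ t + ε) ^ 3 :=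
        pow_le_pow_left₀ (localNorm_nonneg _ _ _) hle 3
      rw [Real.norm_eq_abs, abs_div, abs_neg, abs_div, abs_of_pos (by positivity : 0 < 2 * √(ψ t + ε)),
        abs_of_pos (by positivity : 0 < √(ψ t + ε) ^ 2), div_div, div_le_one (by positivity)]
      calc _ ≤ 2 * localNorm R (x + t • h) h ^ 3 := h3
        _ ≤ 2 * √(ψ t + ε) ^ 3 := by linarith
        _ = _ := by ring
    have hlip := (convex_Icc (0 : ℝ) 1).norm_image_sub_le_of_norm_hasDerivWithin_le hv hb
      (left_mem_Icc.2 zero_le_one) (right_mem_Icc.2 zero_le_one)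
    have h0 := hpos 0 (left_mem_Icc.2 zero_le_one)
    have h1 := hpos 1 (right_mem_Icc.2 zero_le_one)
    have e : (√(ψ 1 + ε))⁻¹ - (√(ψ 0 + ε))⁻¹
        = (√(ψ 0 + ε) - √(ψ 1 + ε)) / (√(ψ 0 + ε) * √(ψ 1 + ε)) := by
      field_simp
    rw [e, Real.norm_eq_abs, abs_div, abs_of_pos (mul_pos h0 h1), div_le_iff₀ (mul_pos h0 h1)] at hlip
    simpa using hlip
  have hc : ∀ a : ℝ, Tendsto (fun ε : ℝ => √(a + ε)) (𝓝[>] 0) (𝓝 √a) := fun a => by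
    have : Continuous fun ε : ℝ => √(a + ε) := by fun_prop
    have h2 := (this.tendsto 0).mono_left (nhdsWithin_le_nhds (s := Ioi 0))
    simpa using h2
  have hlim := le_of_tendsto_of_tendsto ((hc (ψ 0)).sub (hc (ψ 1))).abs
    ((hc (ψ 0)).mul (hc (ψ 1))) (eventually_nhdsWithin_of_forall fun ε hε => key ε hε)
  simpa [hψ, localNorm] using hlim

end IsSelfConcordantBarrier

namespace IsSelfConcordantBarrier

variable {d : ℕ} {K : Set (Euc d)} {R : Euc d → ℝ} {ν D : ℝ}

/-- Comparison of the local norms of the direction `h` at `x` and at `x + t • h`. -/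
theorem localNorm_line_bounds (hR : IsSelfConcordantBarrier K R ν) {x h : Euc d} {t : ℝ}
    (ht : 0 ≤ t) (hseg : ∀ s ∈ Icc (0 : ℝ) t, x + s • h ∈ interior K) :
    localNorm R x h ≤ localNorm R (x + t • h) h * (1 + t * localNorm R x h) ∧
      localNorm R (x + t • h) h * (1 - t * localNorm R x h) ≤ localNorm R x h := by
  rcases ht.eq_or_lt with rfl | ht
  · simp
  have h1 := hR.abs_localNorm_sub_le (x := x) (h := t • h) (fun s hs => by
    rw [smul_smul]
    exact hseg _ ⟨mul_nonneg hs.1 ht.le, by nlinarith [hs.2]⟩)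
  rw [localNorm_smul, localNorm_smul, abs_of_pos ht] at h1
  set a := localNorm R x h
  set b := localNorm R (x + t • h) h
  have h2 := abs_le.1 h1
  constructor
  · have : t * a ≤ t * (b * (1 + t * a)) := by nlinarith [h2.2]
    exact le_of_mul_le_mul_left this ht
  · have : t * (b * (1 - t * a)) ≤ t * a := by nlinarith [h2.1]
    exact le_of_mul_le_mul_left this ht

/-- Strong monotonicity of the gradient in the local norm. -/
theorem le_fderiv_sub (hR : IsSelfConcordantBarrier K R ν) (hK : Convex ℝ K) {x y : Euc d}
    (hx : x ∈ interior K) (hy : y ∈ interior K) :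
    localNorm R x (y - x) ^ 2 / (1 + localNorm R x (y - x)) ≤
      fderiv ℝ R y (y - x) - fderiv ℝ R x (y - x) := by
  set h := y - x with hh
  set r := localNorm R x h with hr
  have hr0 : 0 ≤ r := localNorm_nonneg _ _ _
  have hseg : ∀ t ∈ Icc (0 : ℝ) 1, x + t • h ∈ interior K := fun t ht =>
    hK.interior.add_smul_sub_mem hx hy ht
  have hd : ∀ t ∈ Icc (0 : ℝ) 1, HasDerivAt
      (fun t : ℝ => fderiv ℝ R (x + t • h) h - r ^ 2 * t / (1 + r * t))
      (iteratedFDeriv ℝ 2 R (x + t • h) (fun _ => h) - r ^ 2 / (1 + r * t) ^ 2) t := by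
    intro t ht
    have hpos : 0 < 1 + r * t := by have := mul_nonneg hr0 ht.1; linarith
    have h1 : HasDerivAt (fun t : ℝ => r ^ 2 * t) (r ^ 2) t := by
      simpa using (hasDerivAt_id t).const_mul (r ^ 2)
    have h2 : HasDerivAt (fun t : ℝ => 1 + r * t) r t := by
      simpa using ((hasDerivAt_id t).const_mul r).const_add 1
    have h3 := (h1.div h2 hpos.ne')
    have h4 := (hasDerivAt_fderiv_line (x := x) (h := h)
      ((hR.contDiffAt (hseg t ht)).of_le (by norm_num))).sub h3
    rw [show r ^ 2 / (1 + r * t) ^ 2 = (r ^ 2 * (1 + r * t) - r ^ 2 * t * r) / (1 + r * t) ^ 2 by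
      congr 1; ring]
    exact h4
  have hnn : ∀ t ∈ Icc (0 : ℝ) 1,
      0 ≤ iteratedFDeriv ℝ 2 R (x + t • h) (fun _ => h) - r ^ 2 / (1 + r * t) ^ 2 := by
    intro t ht
    have hpos : 0 < 1 + r * t := by have := mul_nonneg hr0 ht.1; linarith
    have hb := (hR.localNorm_line_bounds ht.1 (h := h) (x := x) (fun s hs =>
      hseg s ⟨hs.1, hs.2.trans ht.2⟩)).1
    rw [← hR.localNorm_sq (hseg t ht), sub_nonneg, div_le_iff₀ (by positivity), ← mul_pow]
    exact pow_le_pow_left₀ hr0 (by rw [mul_comm r t]; exact hb) 2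
  have := le_of_hasDerivAt_nonneg zero_le_one hd hnn
  have e : x + h = y := by simp [hh]
  simp only [zero_smul, add_zero, mul_zero, zero_div, sub_zero, one_smul, mul_one, e] at this
  linarith

/-- A barrier parameter bounds the linearized growth towards any point of the body. -/
theorem fderiv_sub_le (hR : IsSelfConcordantBarrier K R ν) (hK : Convex ℝ K) (hν : 0 < ν)
    {w z : Euc d} (hw : w ∈ interior K) (hz : z ∈ K) : fderiv ℝ R w (z - w) ≤ ν := by
  set h := z - w with hh
  set φ : ℝ → ℝ := fun t => fderiv ℝ R (w + t • h) h with hφ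
  have hseg : ∀ t ∈ Ico (0 : ℝ) 1, w + t • h ∈ interior K := fun t ht => by
    have := hK.add_smul_sub_mem_interior hz hw (t := 1 - t) ⟨by linarith [ht.2], by linarith [ht.1]⟩
    convert this using 1
    rw [hh]; module
  have hφd : ∀ t ∈ Ico (0 : ℝ) 1,
      HasDerivAt φ (iteratedFDeriv ℝ 2 R (w + t • h) (fun _ => h)) t := fun t ht =>
    hasDerivAt_fderiv_line ((hR.contDiffAt (hseg t ht)).of_le (by norm_num))
  have hφ0 : φ 0 = fderiv ℝ R w h := by simp [hφ]
  rw [← hφ0]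
  by_contra! hlt
  have hp : 0 < φ 0 := hν.trans hlt
  have hmono : ∀ t ∈ Ico (0 : ℝ) 1, φ 0 ≤ φ t := fun t ht =>
    le_of_hasDerivAt_nonneg ht.1 (fun s hs => hφd s ⟨hs.1, hs.2.trans_lt ht.2⟩)
      (fun s hs => hR.second_nonneg (hseg s ⟨hs.1, hs.2.trans_lt ht.2⟩) h)
  have hineq : ∀ t ∈ Ico (0 : ℝ) 1, φ t ^ 2 ≤ ν * iteratedFDeriv ℝ 2 R (w + t • h) (fun _ => h) :=
    fun t ht => by
      rw [← hR.localNorm_sq (hseg t ht), ← Real.sq_sqrt hν.le, ← mul_pow, ← sq_abs (φ t)]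
      exact pow_le_pow_left₀ (abs_nonneg _) (hR.grad_le _ (hseg t ht) h) 2
  -- `-1/φ - t/ν` does not decrease, so `φ` blows up at time `ν / φ 0 < 1`
  have hinv : ∀ t ∈ Ico (0 : ℝ) 1, t / ν ≤ (φ 0)⁻¹ := by
    intro t ht
    have hp' : ∀ s ∈ Icc 0 t, 0 < φ s := fun s hs =>
      hp.trans_le (hmono s ⟨hs.1, hs.2.trans_lt ht.2⟩)
    have := le_of_hasDerivAt_nonneg (g := fun s => -(φ s)⁻¹ - s / ν) ht.1
      (fun s hs => ((hφd s ⟨hs.1, hs.2.trans_lt ht.2⟩).inv (hp' s hs).ne').neg.sub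
        ((hasDerivAt_id s).div_const ν)) (fun s hs => by
        have h1 := hineq s ⟨hs.1, hs.2.trans_lt ht.2⟩
        have h2 := hp' s hs
        rw [neg_div, neg_neg, sub_nonneg, div_le_div_iff₀ hν (by positivity)]
        linarith)
    have h2 := inv_pos.2 (hp' t ⟨ht.1, le_rfl⟩)
    simp only [zero_div, sub_zero] at this
    linarith
  -- at `t` strictly between `ν / φ 0` and `1` this is a contradiction
  have h2 := hinv ((ν / φ 0 + 1) / 2) ⟨by positivity, by
    have := (div_lt_one hp).2 hlt; linarith⟩
  have h3 : ν / φ 0 < (ν / φ 0 + 1) / 2 := by have := (div_lt_one hp).2 hlt; linarith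
  have h4 := (div_lt_div_iff_of_pos_right hν).2 h3
  have h5 : ν / φ 0 / ν = (φ 0)⁻¹ := by field_simp
  linarith

/-- The barrier grows at most logarithmically along a segment of the body. -/
theorem sub_le_log (hR : IsSelfConcordantBarrier K R ν) (hK : Convex ℝ K) (hν : 0 < ν)
    {x z : Euc d} (hx : x ∈ interior K) (hz : z ∈ K) {p : ℝ} (hp0 : 0 ≤ p) (hp1 : p < 1) :
    R (x + p • (z - x)) - R x ≤ ν * Real.log (1 / (1 - p)) := by
  set h := z - x with hh
  have hseg : ∀ t ∈ Icc (0 : ℝ) p, x + t • h ∈ interior K := fun t ht => by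
    have := hK.add_smul_sub_mem_interior hz hx (t := 1 - t)
      ⟨by linarith [ht.2], by linarith [ht.1]⟩
    convert this using 1
    rw [hh]; module
  have := le_of_hasDerivAt_nonneg (g := fun t => -(R (x + t • h)) - ν * Real.log (1 - t))
    (g' := fun t => -(fderiv ℝ R (x + t • h) h) - ν * (-1 / (1 - t))) hp0
    (fun t ht => (hasDerivAt_line (hR.differentiableAt (hseg t ht))).neg.sub
      ((((hasDerivAt_id t).const_sub 1).log (by simp; linarith [ht.2])).const_mul ν))
    (fun t ht => by
      have h1 := hR.fderiv_sub_le hK hν (hseg t ht) hz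
      have h2 : z - (x + t • h) = (1 - t) • h := by rw [hh]; module
      have h3 : 0 < 1 - t := by linarith [ht.2]
      rw [h2, map_smul, smul_eq_mul] at h1
      have : fderiv ℝ R (x + t • h) h ≤ ν / (1 - t) := by
        rw [le_div_iff₀ h3]; linarith
      rw [mul_div_assoc', mul_neg_one, neg_div]; linarith)
  rw [Real.log_div one_ne_zero (by linarith), Real.log_one]
  simp at this
  linarith

/-- Points of the body that lie in the half space where the linearization of the barrier at `x`
grows are at local distance at most `ν + 2√ν` from `x`. -/
theorem localNorm_sub_le (hR : IsSelfConcordantBarrier K R ν) (hK : Convex ℝ K) (hν : 0 < ν)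
    {x z : Euc d} (hx : x ∈ interior K) (hz : z ∈ K) (hd : 0 ≤ fderiv ℝ R x (z - x)) :
    localNorm R x (z - x) ≤ ν + 2 * √ν := by
  set r := localNorm R x (z - x) with hr
  by_contra! hlt
  have hsν : 0 < √ν := Real.sqrt_pos.2 hν
  have hsq : √ν ^ 2 = ν := Real.sq_sqrt hν.le
  have hr0 : 0 < r := by linarith
  -- the time that maximizes the quadratic `t ↦ r (r - ν) t - r² t²`
  set t := (r - ν) / (2 * r) with ht
  have ht0 : 0 < t := by rw [ht]; exact div_pos (by linarith) (by linarith)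
  have ht1 : t < 1 := by rw [ht, div_lt_one (by linarith)]; linarith
  have hw : x + t • (z - x) ∈ interior K := by
    have := hK.add_smul_sub_mem_interior hz hx (t := 1 - t) ⟨by linarith, by linarith⟩
    convert this using 1
    module
  have h1 := hR.le_fderiv_sub hK hx hw
  have h2 := hR.fderiv_sub_le hK hν hw hz
  have e1 : x + t • (z - x) - x = t • (z - x) := by module
  have e2 : z - (x + t • (z - x)) = (1 - t) • (z - x) := by module
  rw [e1, localNorm_smul, abs_of_pos ht0, map_smul, map_smul, ← hr, smul_eq_mul, smul_eq_mul] at h1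
  rw [e2, map_smul, smul_eq_mul] at h2
  set p := fderiv ℝ R (x + t • (z - x)) (z - x)
  have htr : 0 < 1 + t * r := by positivity
  rw [div_le_iff₀ htr] at h1
  have h3 : t * r ^ 2 ≤ p * (1 + t * r) := by
    have : t * (t * r ^ 2) ≤ t * (p * (1 + t * r)) := by
      nlinarith [mul_nonneg (mul_nonneg ht0.le hd) htr.le]
    exact le_of_mul_le_mul_left this ht0
  have h4 : (1 - t) * (t * r ^ 2) ≤ ν * (1 + t * r) := by
    calc _ ≤ (1 - t) * (p * (1 + t * r)) := by gcongr
      _ = ((1 - t) * p) * (1 + t * r) := by ring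
      _ ≤ _ := by gcongr
  have htr2 : t * r = (r - ν) / 2 := by rw [ht]; field_simp
  have h5 : (1 - t) * (t * r ^ 2) = (t * r) * (r - t * r) := by ring
  rw [h5, htr2] at h4
  nlinarith [mul_pos (sub_pos.2 hlt) hsν]

end IsSelfConcordantBarrier

/-! ### The Dikin ellipsoid and nondegeneracy of the Hessian -/

theorem IsActionSet.norm_le {d : ℕ} {K : Set (Euc d)} {D : ℝ} (hK : IsActionSet K D) {x : Euc d}
    (hx : x ∈ K) : 2 * ‖x‖ ≤ D := by
  have := hK.diam_le x hx (-x) (hK.symm x hx)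
  rwa [sub_neg_eq_add, ← two_smul ℝ x, norm_smul, Real.norm_of_nonneg zero_le_two] at this

theorem IsActionSet.isCompact {d : ℕ} {K : Set (Euc d)} {D : ℝ} (hK : IsActionSet K D) :
    IsCompact K :=
  Metric.isCompact_of_isClosed_isBounded hK.isClosed
    (isBounded_iff_forall_norm_le.2 ⟨D, fun x hx => by
      have := hK.norm_le hx; have := norm_nonneg x; linarith⟩)

theorem IsActionSet.zero_mem {d : ℕ} {K : Set (Euc d)} {D : ℝ} (hK : IsActionSet K D) :
    (0 : Euc d) ∈ K := hK.unitBall_subset (by simp)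

theorem IsActionSet.diam_nonneg {d : ℕ} {K : Set (Euc d)} {D : ℝ} (hK : IsActionSet K D) :
    0 ≤ D := by simpa using hK.diam_le 0 hK.zero_mem 0 hK.zero_mem

namespace IsSelfConcordantBarrier

variable {d : ℕ} {K : Set (Euc d)} {R : Euc d → ℝ} {ν D : ℝ}

/-- The open Dikin ellipsoid at an interior point lies in the interior: up to the first exit time
the barrier would stay bounded. -/
theorem add_mem_interior (hR : IsSelfConcordantBarrier K R ν) {x h : Euc d}
    (hx : x ∈ interior K) (hh : localNorm R x h < 1) : x + h ∈ interior K := by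
  by_contra hn
  set r := localNorm R x h with hr
  have hr0 : 0 ≤ r := localNorm_nonneg _ _ _
  have hcont : Continuous fun t : ℝ => x + t • h := by fun_prop
  set S : Set ℝ := Icc 0 1 ∩ (fun t : ℝ => x + t • h) ⁻¹' (interior K)ᶜ with hS
  have hSc : IsCompact S :=
    isCompact_Icc.inter_right (isOpen_interior.isClosed_compl.preimage hcont)
  obtain ⟨t₀, ht₀, hleast⟩ := hSc.exists_isLeast ⟨1, ⟨by simp, by simpa using hn⟩⟩
  have hpos : 0 < t₀ := by
    rcases ht₀.1.1.eq_or_lt with h0 | h0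
    · exact absurd hx (by simpa [← h0] using ht₀.2)
    · exact h0
  have hin : ∀ t ∈ Ico 0 t₀, x + t • h ∈ interior K := fun t ht => by
    by_contra hc
    exact absurd (hleast ⟨⟨ht.1, ht.2.le.trans ht₀.1.2⟩, hc⟩) (not_le.2 ht.2)
  have hle : ∀ t ∈ Ico 0 t₀, R (x + t • h) ≤ R x + √ν * (r / (1 - r)) := fun t ht => by
    have hb : ∀ s ∈ Icc 0 t, fderiv ℝ R (x + s • h) h ≤ √ν * (r / (1 - r)) := fun s hs => by
      have hs' : s ∈ Ico 0 t₀ := ⟨hs.1, hs.2.trans_lt ht.2⟩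
      have h1 := (hR.localNorm_line_bounds hs.1 (h := h) (x := x) (fun u hu =>
        hin u ⟨hu.1, hu.2.trans_lt hs'.2⟩)).2
      have hs1 : s ≤ 1 := hs'.2.le.trans ht₀.1.2
      have h2 : localNorm R (x + s • h) h ≤ r / (1 - r) := by
        rw [le_div_iff₀ (by linarith)]
        refine le_trans (mul_le_mul_of_nonneg_left ?_ (localNorm_nonneg _ _ _)) h1
        rw [← hr]; nlinarith
      exact (le_abs_self _).trans ((hR.grad_le _ (hin s hs') h).trans
        (mul_le_mul_of_nonneg_left h2 (Real.sqrt_nonneg _)))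
    have := le_of_hasDerivAt_nonneg (g := fun s => (√ν * (r / (1 - r))) * s - R (x + s • h)) ht.1
      (fun s hs => ((hasDerivAt_id s).const_mul _).sub
        (hasDerivAt_line (hR.differentiableAt (hin s ⟨hs.1, hs.2.trans_lt ht.2⟩))))
      (fun s hs => by have := hb s hs; simp only [mul_one]; linarith)
    have ht1 : t ≤ 1 := ht.2.le.trans ht₀.1.2
    have hB : 0 ≤ √ν * (r / (1 - r)) :=
      mul_nonneg (Real.sqrt_nonneg _) (div_nonneg hr0 (by linarith))
    simp only [mul_zero, zero_smul, add_zero] at this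
    nlinarith
  have hten : Tendsto (fun t : ℝ => x + t • h) (𝓝[<] t₀) (𝓝[interior K] (x + t₀ • h)) := by
    refine tendsto_nhdsWithin_iff.2 ⟨(hcont.tendsto t₀).mono_left nhdsWithin_le_nhds, ?_⟩
    filter_upwards [Ioo_mem_nhdsLT hpos] with t ht using hin t ⟨ht.1.le, ht.2⟩
  have hfr : x + t₀ • h ∈ frontier K := by
    refine ⟨?_, ht₀.2⟩
    exact closure_mono interior_subset
      (mem_closure_of_tendsto (hten.mono_right nhdsWithin_le_nhds) (by
        filter_upwards [Ioo_mem_nhdsLT hpos] with t ht using hin t ⟨ht.1.le, ht.2⟩))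
  have htop := (hR.tendsto_atTop _ hfr).comp hten
  have h1 := htop.eventually_gt_atTop (R x + √ν * (r / (1 - r)))
  obtain ⟨t, ht, ht'⟩ := (h1.and (Ioo_mem_nhdsLT hpos)).exists
  exact absurd (hle t ⟨ht'.1.le, ht'.2⟩) (not_le.2 ht)

/-- The closed Dikin ellipsoid at an interior point lies in the body. -/
theorem add_mem (hR : IsSelfConcordantBarrier K R ν) (hK : IsClosed K) {x h : Euc d}
    (hx : x ∈ interior K) (hh : localNorm R x h ≤ 1) : x + h ∈ K := by
  have hcont : Continuous fun t : ℝ => x + t • h := by fun_prop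
  have hten : Tendsto (fun t : ℝ => x + t • h) (𝓝[<] 1) (𝓝 (x + h)) := by
    simpa using (hcont.tendsto 1).mono_left (nhdsWithin_le_nhds (s := Iio 1))
  refine hK.mem_of_tendsto hten ?_
  filter_upwards [Ioo_mem_nhdsLT (zero_lt_one' ℝ)] with t ht
  refine interior_subset (hR.add_mem_interior hx ?_)
  rw [localNorm_smul, abs_of_pos ht.1]
  nlinarith [ht.1, ht.2, localNorm_nonneg R x h]

/-- On a bounded body the Hessian of a barrier is positive definite: otherwise a Dikin ellipsoid
would contain a line. -/
theorem localNorm_pos (hR : IsSelfConcordantBarrier K R ν) (hK : IsActionSet K D) {x h : Euc d}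
    (hx : x ∈ interior K) (hh : h ≠ 0) : 0 < localNorm R x h := by
  refine (localNorm_nonneg _ _ _).lt_of_ne' fun h0 => ?_
  have hmem : ∀ c : ℝ, x + c • h ∈ K := fun c =>
    interior_subset (hR.add_mem_interior hx (by rw [localNorm_smul, h0]; simp))
  have hn : 0 < ‖h‖ := norm_pos_iff.2 hh
  have h1 := hK.diam_le _ (hmem ((D + 1) / ‖h‖)) _ (interior_subset hx)
  rw [add_sub_cancel_left, norm_smul, Real.norm_eq_abs,
    abs_of_nonneg (div_nonneg (by linarith [hK.diam_nonneg]) hn.le), div_mul_cancel₀ _ hn.ne'] at h1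
  linarith

end IsSelfConcordantBarrier

/-! ### The shrunk body -/

section Shrunk

variable {d : ℕ} {K : Set (Euc d)} {R : Euc d → ℝ} {ν D δ : ℝ}

theorem smul_mem_shrunk (hδ1 : δ < 1) {z : Euc d} (hz : z ∈ K) : (1 - δ) • z ∈ shrunk K δ := by
  have : (1 - δ) ≠ 0 := by linarith
  simpa [shrunk, smul_smul, this] using hz

theorem exists_eq_smul_of_mem_shrunk (hδ1 : δ < 1) {x : Euc d} (hx : x ∈ shrunk K δ) :
    ∃ z ∈ K, x = (1 - δ) • z :=
  ⟨_, hx, by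
    have : (1 - δ) ≠ 0 := by linarith
    simp [smul_smul, this]⟩

namespace IsActionSet

theorem zero_mem_interior (hK : IsActionSet K D) : (0 : Euc d) ∈ interior K :=
  interior_mono hK.unitBall_subset
    (interior_mono Metric.ball_subset_closedBall (by simp [Metric.isOpen_ball.interior_eq]))

theorem combo_mem (hK : IsActionSet K D) {z w : Euc d} (hz : z ∈ K) (hw : w ∈ K) {a b : ℝ}
    (hab : |a| + |b| ≤ 1) : a • z + b • w ∈ K := by
  have habs : ∀ {u : Euc d} (c : ℝ), u ∈ K → ∃ u' ∈ K, c • u = |c| • u' := fun {u} c hu => by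
    rcases abs_cases c with ⟨h, -⟩ | ⟨h, -⟩
    · exact ⟨u, hu, by rw [h]⟩
    · exact ⟨-u, hK.symm u hu, by rw [h]; simp⟩
  obtain ⟨z', hz', e1⟩ := habs a hz
  obtain ⟨w', hw', e2⟩ := habs b hw
  rw [e1, e2]
  have h0 := hK.zero_mem
  have h1 : Convex ℝ K := hK.convex
  have := h1.sum_mem (t := Finset.univ) (w := ![|a|, |b|, 1 - |a| - |b|]) (z := ![z', w', 0])
    (by intro i _; fin_cases i <;> simp; linarith)
    (by simp [Fin.sum_univ_three])
    (by intro i _; fin_cases i <;> simp [hz', hw', h0])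
  simpa [Fin.sum_univ_three] using this

theorem convex_shrunk (hK : IsActionSet K D) : Convex ℝ (shrunk K δ) :=
  hK.convex.is_linear_preimage (IsLinearMap.isLinearMap_smul _)

theorem isClosed_shrunk (hK : IsActionSet K D) : IsClosed (shrunk K δ) :=
  hK.isClosed.preimage (continuous_const_smul _)

theorem shrunk_subset_interior (hK : IsActionSet K D) (hδ0 : 0 < δ) (hδ1 : δ < 1) :
    shrunk K δ ⊆ interior K := fun x hx => by
  obtain ⟨z, hz, rfl⟩ := exists_eq_smul_of_mem_shrunk hδ1 hx
  have := hK.convex.add_smul_sub_mem_interior hz hK.zero_mem_interior (t := δ) ⟨hδ0, hδ1.le⟩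
  convert this using 1
  module

theorem isCompact_shrunk (hK : IsActionSet K D) (hδ0 : 0 < δ) (hδ1 : δ < 1) :
    IsCompact (shrunk K δ) :=
  hK.isCompact.of_isClosed_subset hK.isClosed_shrunk
    ((hK.shrunk_subset_interior hδ0 hδ1).trans interior_subset)

theorem zero_mem_shrunk (hK : IsActionSet K D) : (0 : Euc d) ∈ shrunk K δ := by
  simpa [shrunk] using hK.zero_mem

end IsActionSet

/-- Local distances within the shrunk body. Along either direction of the line through `x` and `y`
the body extends `x` by `δ / (2 (1 - δ))` times `y - x`, and the barrier grows in one of them. -/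
theorem IsSelfConcordantBarrier.localNorm_sub_le_of_mem_shrunk
    (hR : IsSelfConcordantBarrier K R ν) (hK : IsActionSet K D) (hν : 0 < ν) (hδ0 : 0 < δ)
    (hδ1 : δ < 1) {x y : Euc d} (hx : x ∈ shrunk K δ) (hy : y ∈ shrunk K δ) :
    localNorm R x (y - x) ≤ 2 * (ν + 2 * √ν) * ((1 - δ) / δ) := by
  have hxi := hK.shrunk_subset_interior hδ0 hδ1 hx
  have h1δ : 0 < 1 - δ := by linarith
  set ε := δ / (2 * (1 - δ)) with hε
  have hε0 : 0 < ε := by positivity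
  have hεδ : ε * (1 - δ) = δ / 2 := by rw [hε]; field_simp
  have key : ∀ c : ℝ, |c| = ε → 0 ≤ c * fderiv ℝ R x (y - x) →
      localNorm R x (y - x) ≤ 2 * (ν + 2 * √ν) * ((1 - δ) / δ) := by
    intro c hc hg
    have hmem : x + c • (y - x) ∈ K := by
      obtain ⟨z, hz, e1⟩ := exists_eq_smul_of_mem_shrunk hδ1 hx
      obtain ⟨w, hw, e2⟩ := exists_eq_smul_of_mem_shrunk hδ1 hy
      have := hK.combo_mem hz hw (a := (1 - c) * (1 - δ)) (b := c * (1 - δ)) (by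
        rw [abs_mul, abs_mul, abs_of_pos h1δ, hc]
        have h2 : |1 - c| ≤ 1 + ε := by
          calc |1 - c| ≤ |1| + |c| := abs_sub _ _
            _ = _ := by rw [abs_one, hc]
        nlinarith)
      convert this using 1
      rw [e1, e2]; module
    have := hR.localNorm_sub_le hK.convex hν hxi hmem (by simpa using hg)
    rw [add_sub_cancel_left, localNorm_smul, hc] at this
    have h3 : localNorm R x (y - x) ≤ (ν + 2 * √ν) / ε := by
      rw [le_div_iff₀ hε0]; linarith
    refine h3.trans_eq ?_
    rw [hε]; field_simp
  rcases le_total 0 (fderiv ℝ R x (y - x)) with h | h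
  · exact key ε (abs_of_pos hε0) (mul_nonneg hε0.le h)
  · exact key (-ε) (by rw [abs_neg, abs_of_pos hε0]) (by nlinarith)

/-- The comparator `(1 - δ)² z` has barrier value at most `ν ln (1/δ)` above that of any point
`(1 - δ) u` of the shrunk body: seen from this point, it lies at the fraction `1 - δ` of the way to
`(1 - δ) z - δ u`, a point of the body. -/
theorem IsSelfConcordantBarrier.sub_le_log_of_mem_shrunk
    (hR : IsSelfConcordantBarrier K R ν) (hK : IsActionSet K D) (hν : 0 < ν) (hδ0 : 0 < δ)
    (hδ1 : δ < 1) {x z : Euc d} (hx : x ∈ shrunk K δ) (hz : z ∈ K) :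
    R ((1 - δ) ^ 2 • z) - R x ≤ ν * Real.log (1 / δ) := by
  have hxi := hK.shrunk_subset_interior hδ0 hδ1 hx
  obtain ⟨u, hu, e⟩ := exists_eq_smul_of_mem_shrunk hδ1 hx
  have hw := hK.combo_mem hz hu (a := 1 - δ) (b := -δ) (by
    rw [abs_neg, abs_of_pos hδ0, abs_of_pos (by linarith)]; linarith)
  have := hR.sub_le_log hK.convex hν hxi hw (p := 1 - δ) (by linarith) (by linarith)
  have e2 : x + (1 - δ) • ((1 - δ) • z + -δ • u - x) = (1 - δ) ^ 2 • z := by rw [e]; module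
  rwa [e2, sub_sub_cancel] at this

/-! ### Regularized leaders -/

theorem IsSelfConcordantBarrier.continuousOn_shrunk (hR : IsSelfConcordantBarrier K R ν)
    (hK : IsActionSet K D) (hδ0 : 0 < δ) (hδ1 : δ < 1) : ContinuousOn R (shrunk K δ) :=
  hR.contDiffOn.continuousOn.mono (hK.shrunk_subset_interior hδ0 hδ1)

/-- First order condition for a minimizer of a linear function plus the barrier. -/
theorem IsSelfConcordantBarrier.first_order (hR : IsSelfConcordantBarrier K R ν)
    (hK : IsActionSet K D) (hδ0 : 0 < δ) (hδ1 : δ < 1) {v x y : Euc d} (hx : x ∈ shrunk K δ)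
    (hmin : IsMinOn (fun z => ⟪v, z⟫_ℝ + R z) (shrunk K δ) x) (hy : y ∈ shrunk K δ) :
    0 ≤ ⟪v, y - x⟫_ℝ + fderiv ℝ R x (y - x) := by
  have hd : HasFDerivWithinAt (fun z => ⟪v, z⟫_ℝ + R z) (innerSL ℝ v + fderiv ℝ R x)
      (shrunk K δ) x :=
    ((innerSL ℝ v).hasFDerivAt.add
      (hR.differentiableAt (hK.shrunk_subset_interior hδ0 hδ1 hx)).hasFDerivAt).hasFDerivWithinAt
  have := hmin.localize.hasFDerivWithinAt_nonneg hd (y := y - x)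
    (mem_posTangentConeAt_of_segment_subset (by
      rw [add_sub_cancel]; exact hK.convex_shrunk.segment_subset hx hy))
  simpa using this

/-- Stability of the regularized leader under a change of the linear function. -/
theorem IsSelfConcordantBarrier.stability (hR : IsSelfConcordantBarrier K R ν)
    (hK : IsActionSet K D) (hδ0 : 0 < δ) (hδ1 : δ < 1) {v w x y : Euc d} (hx : x ∈ shrunk K δ)
    (hxmin : IsMinOn (fun z => ⟪v, z⟫_ℝ + R z) (shrunk K δ) x) (hy : y ∈ shrunk K δ)
    (hymin : IsMinOn (fun z => ⟪w, z⟫_ℝ + R z) (shrunk K δ) y) :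
    localNorm R x (y - x) ^ 2 / (1 + localNorm R x (y - x)) ≤ ⟪w - v, x - y⟫_ℝ := by
  have h1 := hR.first_order hK hδ0 hδ1 hx hxmin hy
  have h2 := hR.first_order hK hδ0 hδ1 hy hymin hx
  have h3 := hR.le_fderiv_sub hK.convex (hK.shrunk_subset_interior hδ0 hδ1 hx)
    (hK.shrunk_subset_interior hδ0 hδ1 hy)
  have e : x - y = -(y - x) := by abel
  rw [e, map_neg, inner_neg_right] at h2
  rw [e, inner_neg_right, inner_sub_left]
  linarith

theorem IsSelfConcordantBarrier.eq_of_isMinOn (hR : IsSelfConcordantBarrier K R ν)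
    (hK : IsActionSet K D) (hδ0 : 0 < δ) (hδ1 : δ < 1) {v x y : Euc d} (hx : x ∈ shrunk K δ)
    (hxmin : IsMinOn (fun z => ⟪v, z⟫_ℝ + R z) (shrunk K δ) x) (hy : y ∈ shrunk K δ)
    (hymin : IsMinOn (fun z => ⟪v, z⟫_ℝ + R z) (shrunk K δ) y) : x = y := by
  have h := hR.stability hK hδ0 hδ1 hx hxmin hy hymin
  rw [sub_self, inner_zero_left] at h
  by_contra hne
  have hpos := hR.localNorm_pos hK (hK.shrunk_subset_interior hδ0 hδ1 hx)
    (sub_ne_zero.2 (Ne.symm hne))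
  exact absurd h (not_le.2 (by positivity))

/-- The regularized leader exists, is unique, and depends continuously on the linear function: its
graph is closed and the shrunk body is compact. -/
theorem IsSelfConcordantBarrier.exists_leader (hR : IsSelfConcordantBarrier K R ν)
    (hK : IsActionSet K D) (hδ0 : 0 < δ) (hδ1 : δ < 1) :
    ∃ M : Euc d → Euc d, Continuous M ∧ ∀ v, M v ∈ shrunk K δ ∧
      IsMinOn (fun z => ⟪v, z⟫_ℝ + R z) (shrunk K δ) (M v) ∧
      ∀ x ∈ shrunk K δ, IsMinOn (fun z => ⟪v, z⟫_ℝ + R z) (shrunk K δ) x → x = M v := by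
  have hcomp := hK.isCompact_shrunk hδ0 hδ1
  have hcont := hR.continuousOn_shrunk hK hδ0 hδ1
  have hex : ∀ v : Euc d, ∃ x ∈ shrunk K δ,
      IsMinOn (fun z => ⟪v, z⟫_ℝ + R z) (shrunk K δ) x := fun v =>
    hcomp.exists_isMinOn ⟨0, hK.zero_mem_shrunk⟩
      ((Continuous.inner continuous_const continuous_id).continuousOn.add hcont)
  choose M hM hmin using hex
  have huniq : ∀ v, ∀ x ∈ shrunk K δ, IsMinOn (fun z => ⟪v, z⟫_ℝ + R z) (shrunk K δ) x →
      x = M v := fun v x hx hxm => hR.eq_of_isMinOn hK hδ0 hδ1 hx hxm (hM v) (hmin v)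
  refine ⟨M, ?_, fun v => ⟨hM v, hmin v, huniq v⟩⟩
  have : CompactSpace (shrunk K δ) := isCompact_iff_compactSpace.1 hcomp
  set M' : Euc d → shrunk K δ := fun v => ⟨M v, hM v⟩ with hM'
  have hcR : Continuous fun z : shrunk K δ => R z := continuousOn_iff_continuous_domRestrict.1 hcont
  have hgraph : {p : Euc d × shrunk K δ | p.2 = M' p.1} =
      ⋂ w : shrunk K δ, {p | ⟪p.1, (p.2 : Euc d)⟫_ℝ + R p.2 ≤ ⟪p.1, (w : Euc d)⟫_ℝ + R w} := by
    ext ⟨v, z⟩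
    simp only [mem_ofPred_eq, mem_iInter]
    constructor
    · rintro rfl w
      exact hmin v w.2
    · intro h
      exact Subtype.ext (huniq v z z.2 fun w hw => h ⟨w, hw⟩)
  have hclosed : IsClosed {p : Euc d × shrunk K δ | p.2 = M' p.1} := by
    rw [hgraph]
    refine isClosed_iInter fun w => isClosed_le ?_ ?_
    · exact (continuous_fst.inner (continuous_subtype_val.comp continuous_snd)).add
        (hcR.comp continuous_snd)
    · exact (continuous_fst.inner continuous_const).add continuous_const
  have hM'c : Continuous M' := by
    refine continuous_iff_isClosed.2 fun s hs => ?_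
    have h1 := (isClosedMap_fst_of_compactSpace (X := Euc d) (Y := shrunk K δ)) _
      (hclosed.inter (hs.preimage continuous_snd))
    convert h1 using 1
    ext v
    simp only [mem_preimage, mem_image, mem_inter_iff, mem_ofPred_eq, Prod.exists, exists_and_right,
      exists_eq_right]
    exact ⟨fun h => ⟨_, rfl, h⟩, fun ⟨z, hz, h⟩ => hz ▸ h⟩
  exact continuous_subtype_val.comp hM'c

/-! ### Regret of the regularized leaders against linear losses -/

/-- The regret of following the regularized leader against linear losses whose dual local norms
are at most `b`, when `η b ≤ 1/2`. -/
theorem IsSelfConcordantBarrier.leader_regret (hR : IsSelfConcordantBarrier K R ν)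
    (hK : IsActionSet K D) (hδ0 : 0 < δ) (hδ1 : δ < 1) {T : ℕ} {η b : ℝ} (hη : 0 < η)
    (hb : 0 ≤ b) (hq : η * b ≤ 1 / 2) {g x : Fin T → Euc d} (hx : ∀ t, x t ∈ shrunk K δ)
    (hmin : ∀ t, IsMinOn (fun z => η * ∑ τ ∈ Finset.Iio t, ⟪g τ, z⟫_ℝ + R z)
      (shrunk K δ) (x t))
    (hg : ∀ t h, |⟪g t, h⟫_ℝ| ≤ b * localNorm R (x t) h) {y : Euc d} (hy : y ∈ shrunk K δ)
    {B : ℝ} (hB : ∀ w ∈ shrunk K δ, R y - R w ≤ B) :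
    ∑ t, ⟪g t, x t - y⟫_ℝ ≤ 2 * η * b ^ 2 * T + B / η := by
  obtain ⟨M, -, hM⟩ := hR.exists_leader hK hδ0 hδ1
  set γ : ℕ → Euc d := fun i => if h : i < T then g ⟨i, h⟩ else 0 with hγ
  set V : ℕ → Euc d := fun n => η • ∑ i ∈ Finset.range n, γ i with hV
  have hγt : ∀ t : Fin T, γ t = g t := fun t => by simp [hγ]
  have hsum : ∀ t : Fin T, ∑ τ ∈ Finset.Iio t, g τ = ∑ i ∈ Finset.range t, γ i := fun t => by
    rw [← Nat.Iio_eq_range, ← Fin.map_valEmbedding_Iio, Finset.sum_map]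
    exact Finset.sum_congr rfl fun τ _ => (hγt τ).symm
  have hxM : ∀ t : Fin T, x t = M (V t) := fun t => (hM _).2.2 _ (hx t) (by
    have := hmin t
    simp only [← sum_inner, hsum] at this
    simpa only [hV, inner_smul_left, conj_trivial] using this)
  have hVs : ∀ n, V (n + 1) = V n + η • γ n := fun n => by
    simp only [hV, Finset.sum_range_succ, smul_add]
  have hlead : ∀ n : ℕ, ∀ z ∈ shrunk K δ,
      ∑ i ∈ Finset.range n, ⟪η • γ i, M (V (i + 1))⟫_ℝ + R (M (V 0)) ≤ ⟪V n, z⟫_ℝ + R z := by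
    intro n
    induction n with
    | zero =>
      intro z hz
      have := (hM (V 0)).2.1 hz
      simpa [hV] using this
    | succ n ih =>
      intro z hz
      have h1 := ih _ (hM (V (n + 1))).1
      have h2 : ⟪V (n + 1), M (V (n + 1))⟫_ℝ + R (M (V (n + 1))) ≤ ⟪V (n + 1), z⟫_ℝ + R z :=
        (hM (V (n + 1))).2.1 hz
      rw [Finset.sum_range_succ]
      have h3 : ⟪V (n + 1), M (V (n + 1))⟫_ℝ =
          ⟪V n, M (V (n + 1))⟫_ℝ + ⟪η • γ n, M (V (n + 1))⟫_ℝ := by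
        rw [← inner_add_left, ← hVs]
      linarith
  have hstab : ∀ t : Fin T, ⟪η • γ t, M (V t) - M (V (t + 1))⟫_ℝ ≤ 2 * (η * b) ^ 2 := by
    intro t
    have h1 := hR.stability hK hδ0 hδ1 (hM (V t)).1 (hM (V t)).2.1 (hM (V (t + 1))).1
      (hM (V (t + 1))).2.1
    set r := localNorm R (M (V t)) (M (V (t + 1)) - M (V t)) with hr
    have hr0 : 0 ≤ r := localNorm_nonneg _ _ _
    have hVd : V (t + 1) - V t = η • γ t := by rw [hVs, add_sub_cancel_left]
    rw [hVd] at h1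
    have h2 : ⟪η • γ t, M (V t) - M (V (t + 1))⟫_ℝ ≤ η * b * r := by
      rw [hγt, real_inner_smul_left, mul_assoc]
      refine mul_le_mul_of_nonneg_left ?_ hη.le
      have h3 := hg t (M (V (t + 1)) - M (V t))
      rw [hxM t, ← hr] at h3
      rw [← neg_sub, inner_neg_right]
      exact (neg_le_abs _).trans h3
    have hq0 : 0 ≤ η * b := by positivity
    have h4 : r ≤ 2 * (η * b) := by
      have h5 := h1.trans h2
      rw [div_le_iff₀ (by linarith)] at h5
      rcases hr0.eq_or_lt with h0 | h0
      · rw [← h0]; positivity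
      · have : r ≤ η * b * (1 + r) := by
          refine le_of_mul_le_mul_left ?_ h0
          nlinarith
        nlinarith
    nlinarith
  have h1 := hlead T y hy
  have h2 : ∑ i ∈ Finset.range T, ⟪η • γ i, M (V i) - M (V (i + 1))⟫_ℝ ≤ T * (2 * (η * b) ^ 2) := by
    rw [Finset.sum_range]
    calc _ ≤ ∑ _t : Fin T, 2 * (η * b) ^ 2 := Finset.sum_le_sum fun t _ => hstab t
      _ = _ := by simp
  have h3 : η * ∑ t, ⟪g t, x t - y⟫_ℝ = ∑ i ∈ Finset.range T, ⟪η • γ i, M (V i) - M (V (i + 1))⟫_ℝ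
      + ∑ i ∈ Finset.range T, ⟪η • γ i, M (V (i + 1))⟫_ℝ - ⟪V T, y⟫_ℝ := by
    have e1 : ⟪V T, y⟫_ℝ = ∑ i ∈ Finset.range T, ⟪η • γ i, y⟫_ℝ := by
      simp only [hV, Finset.smul_sum, sum_inner]
    rw [e1, ← Finset.sum_add_distrib, ← Finset.sum_sub_distrib, Finset.sum_range, Finset.mul_sum]
    refine Finset.sum_congr rfl fun t _ => ?_
    rw [hγt, hxM t, ← inner_add_right, ← inner_sub_right, real_inner_smul_left]
    congr 2; abel
  have h4 := hB _ (hM (V 0)).1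
  have h5 : η * ∑ t, ⟪g t, x t - y⟫_ℝ ≤ η * (2 * η * b ^ 2 * T + B / η) := by
    have : η * (2 * η * b ^ 2 * T + B / η) = T * (2 * (η * b) ^ 2) + B := by field_simp
    rw [this]; linarith
  exact le_of_mul_le_mul_left h5 hη

end Shrunk

/-! ### The inverse square root of the Hessian -/

section Matrices

variable {n : Type*} [Fintype n] [DecidableEq n] {H : Matrix n n ℝ}

theorem Matrix.PosDef.spectrum_pos (hH : H.PosDef) {s : ℝ} (hs : s ∈ spectrum ℝ H) : 0 < s := by
  obtain ⟨i, rfl⟩ := hH.isHermitian.spectrum_real_eq_range_eigenvalues ▸ hs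
  exact hH.eigenvalues_pos i

theorem Matrix.continuousOn_spectrum (f : ℝ → ℝ) : ContinuousOn f (spectrum ℝ H) :=
  H.finite_real_spectrum.continuousOn f

theorem Matrix.PosDef.cfc_rpow_neg_half_mul (hH : H.PosDef) :
    cfc (fun s : ℝ => s ^ (-(1 / 2) : ℝ)) H * cfc (fun s : ℝ => √s) H = 1 := by
  rw [← cfc_mul _ _ H (Matrix.continuousOn_spectrum _) (Matrix.continuousOn_spectrum _),
    ← cfc_const_one ℝ H hH.isHermitian]
  refine cfc_congr fun s hs => ?_
  have := hH.spectrum_pos hs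
  rw [Real.sqrt_eq_rpow, ← Real.rpow_add this]
  simp

theorem Matrix.PosDef.cfc_sqrt_mul_self (hH : H.PosDef) :
    cfc (fun s : ℝ => √s) H * cfc (fun s : ℝ => √s) H = H := by
  rw [← cfc_mul _ _ H (Matrix.continuousOn_spectrum _) (Matrix.continuousOn_spectrum _)]
  conv_rhs => rw [← cfc_id' ℝ H hH.isHermitian]
  exact cfc_congr fun s hs => Real.mul_self_sqrt (hH.spectrum_pos hs).le

theorem Matrix.PosDef.inv_cfc_rpow_neg_half (hH : H.PosDef) :
    (cfc (fun s : ℝ => s ^ (-(1 / 2) : ℝ)) H)⁻¹ = cfc (fun s : ℝ => √s) H :=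
  Matrix.inv_eq_right_inv hH.cfc_rpow_neg_half_mul

theorem exists_polynomial_tendsto_rpow_neg_half :
    ∃ p : ℕ → Polynomial ℝ, ∀ s : ℝ, 0 < s →
      Tendsto (fun k => (p k).eval s) atTop (𝓝 (s ^ (-(1 / 2) : ℝ))) := by
  have h : ∀ k : ℕ, ∃ p : Polynomial ℝ, ∀ s ∈ Icc (1 / ((k : ℝ) + 1)) (k + 1),
      |p.eval s - s ^ (-(1 / 2) : ℝ)| < 1 / ((k : ℝ) + 1) := fun k => by
    refine exists_polynomial_near_of_continuousOn _ _ _ (fun s hs => ?_) _ (by positivity)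
    have : 0 < s := lt_of_lt_of_le (by positivity) hs.1
    exact (Real.continuousAt_rpow_const s _ (Or.inl this.ne')).continuousWithinAt
  choose p hp using h
  refine ⟨p, fun s hs => ?_⟩
  rw [tendsto_iff_norm_sub_tendsto_zero]
  refine squeeze_zero' (Eventually.of_forall fun _ => norm_nonneg _) ?_
    tendsto_one_div_add_atTop_nhds_zero_nat
  have h1 : ∀ᶠ k : ℕ in atTop, 1 / ((k : ℝ) + 1) < s :=
    (tendsto_one_div_add_atTop_nhds_zero_nat (𝕜 := ℝ)).eventually_lt_const hs
  have h2 : ∀ᶠ k : ℕ in atTop, s ≤ k :=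
    tendsto_natCast_atTop_atTop.eventually_ge_atTop s
  filter_upwards [h1, h2] with k hk1 hk2
  exact (hp k s ⟨hk1.le, by linarith⟩).le

theorem Matrix.IsHermitian.tendsto_cfc (hH : H.IsHermitian) {f : ℕ → ℝ → ℝ} {g : ℝ → ℝ}
    (h : ∀ s ∈ spectrum ℝ H, Tendsto (fun k => f k s) atTop (𝓝 (g s))) :
    Tendsto (fun k => cfc (f k) H) atTop (𝓝 (cfc g H)) := by
  simp only [hH.cfc_eq, Matrix.IsHermitian.cfc, Unitary.conjStarAlgAut_apply]
  refine Tendsto.mul (Tendsto.mul tendsto_const_nhds ?_) tendsto_const_nhds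
  have hcont : Continuous (Matrix.diagonal : (n → ℝ) → Matrix n n ℝ) :=
    Continuous.matrix_diagonal continuous_id
  refine (hcont.tendsto _).comp (tendsto_pi_nhds.2 fun i => ?_)
  exact h _ (hH.eigenvalues_mem_spectrum_real i)

end Matrices

section Hessian

variable {d : ℕ} {K : Set (Euc d)} {R : Euc d → ℝ} {ν D : ℝ}

theorem toEuclideanLin_mul_apply (A B : Matrix (Fin d) (Fin d) ℝ) (v : Euc d) :
    Matrix.toEuclideanLin (A * B) v = Matrix.toEuclideanLin A (Matrix.toEuclideanLin B v) := by
  simp [Matrix.toLpLin_apply, Matrix.mulVec_mulVec]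

theorem isHermitian_invSqrtHessian (R : Euc d → ℝ) (x : Euc d) :
    (invSqrtHessian R x).IsHermitian :=
  (cfc_predicate (p := IsSelfAdjoint) _ _).isHermitian

theorem inner_invSqrtHessian_comm (R : Euc d → ℝ) (x u v : Euc d) :
    ⟪Matrix.toEuclideanLin (invSqrtHessian R x) u, v⟫_ℝ =
      ⟪u, Matrix.toEuclideanLin (invSqrtHessian R x) v⟫_ℝ :=
  Matrix.isSymmetric_toEuclideanLin_iff.2 (isHermitian_invSqrtHessian R x) u v

theorem inner_inv_invSqrtHessian_comm (R : Euc d → ℝ) (x u v : Euc d) :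
    ⟪Matrix.toEuclideanLin (invSqrtHessian R x)⁻¹ u, v⟫_ℝ =
      ⟪u, Matrix.toEuclideanLin (invSqrtHessian R x)⁻¹ v⟫_ℝ :=
  Matrix.isSymmetric_toEuclideanLin_iff.2 (isHermitian_invSqrtHessian R x).inv u v

theorem inner_hessian (R : Euc d → ℝ) (x h : Euc d) :
    ⟪h, Matrix.toEuclideanLin (hessian R x) h⟫_ℝ = iteratedFDeriv ℝ 2 R x (fun _ => h) := by
  rw [iteratedFDeriv_two_apply]
  have hh : h = ∑ i, h i • EuclideanSpace.single i (1 : ℝ) := by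
    simpa using ((EuclideanSpace.basisFun (Fin d) ℝ).sum_repr h).symm
  conv_rhs => rw [hh]
  simp only [map_sum, map_smul, sum_apply, smul_apply,
    smul_eq_mul]
  simp only [PiLp.inner_apply, Matrix.ofLp_toLpLin, Matrix.toLin'_apply, Matrix.mulVec, dotProduct, hessian,
    Matrix.of_apply, iteratedFDeriv_two_apply, RCLike.inner_apply, conj_trivial,
    Matrix.cons_val_zero, Matrix.cons_val_one, Finset.sum_mul, Finset.mul_sum]
  rw [Finset.sum_comm]
  refine Finset.sum_congr rfl fun i _ => Finset.sum_congr rfl fun j _ => ?_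
  ring

namespace IsSelfConcordantBarrier

theorem isHermitian_hessian (hR : IsSelfConcordantBarrier K R ν) {x : Euc d}
    (hx : x ∈ interior K) : (hessian R x).IsHermitian := by
  refine Matrix.IsHermitian.ext fun i j => ?_
  have := ((hR.contDiffAt hx).isSymmSndFDerivAt (by simp; norm_num))
    (EuclideanSpace.single i 1) (EuclideanSpace.single j 1)
  simp [hessian, iteratedFDeriv_two_apply, this]

theorem posDef_hessian (hR : IsSelfConcordantBarrier K R ν) (hK : IsActionSet K D) {x : Euc d}
    (hx : x ∈ interior K) : (hessian R x).PosDef := by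
  refine Matrix.PosDef.of_dotProduct_mulVec_pos (hR.isHermitian_hessian hx) fun v hv => ?_
  have h1 := hR.localNorm_pos hK hx (h := WithLp.toLp 2 v) (by simpa using hv)
  have h2 : 0 < ⟪WithLp.toLp 2 v, Matrix.toEuclideanLin (hessian R x) (WithLp.toLp 2 v)⟫_ℝ := by
    rw [inner_hessian, ← hR.localNorm_sq hx]; positivity
  rw [EuclideanSpace.inner_eq_star_dotProduct, dotProduct_comm] at h2
  exact h2

theorem inv_invSqrtHessian (hR : IsSelfConcordantBarrier K R ν) (hK : IsActionSet K D) {x : Euc d}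
    (hx : x ∈ interior K) :
    (invSqrtHessian R x)⁻¹ = cfc (fun s : ℝ => √s) (hessian R x) :=
  (hR.posDef_hessian hK hx).inv_cfc_rpow_neg_half

theorem inv_invSqrtHessian_mul_self (hR : IsSelfConcordantBarrier K R ν) (hK : IsActionSet K D)
    {x : Euc d} (hx : x ∈ interior K) :
    (invSqrtHessian R x)⁻¹ * (invSqrtHessian R x)⁻¹ = hessian R x := by
  rw [hR.inv_invSqrtHessian hK hx]
  exact (hR.posDef_hessian hK hx).cfc_sqrt_mul_self

theorem invSqrtHessian_mul_inv (hR : IsSelfConcordantBarrier K R ν) (hK : IsActionSet K D)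
    {x : Euc d} (hx : x ∈ interior K) :
    invSqrtHessian R x * (invSqrtHessian R x)⁻¹ = 1 := by
  rw [hR.inv_invSqrtHessian hK hx]
  exact (hR.posDef_hessian hK hx).cfc_rpow_neg_half_mul

theorem invSqrtHessian_inv_apply (hR : IsSelfConcordantBarrier K R ν) (hK : IsActionSet K D)
    {x : Euc d} (hx : x ∈ interior K) (v : Euc d) :
    Matrix.toEuclideanLin (invSqrtHessian R x)
      (Matrix.toEuclideanLin (invSqrtHessian R x)⁻¹ v) = v := by
  rw [← toEuclideanLin_mul_apply, hR.invSqrtHessian_mul_inv hK hx]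
  simp

theorem inv_invSqrtHessian_apply (hR : IsSelfConcordantBarrier K R ν) (hK : IsActionSet K D)
    {x : Euc d} (hx : x ∈ interior K) (v : Euc d) :
    Matrix.toEuclideanLin (invSqrtHessian R x)⁻¹
      (Matrix.toEuclideanLin (invSqrtHessian R x) v) = v := by
  rw [← toEuclideanLin_mul_apply, _root_.mul_eq_one_comm.1 (hR.invSqrtHessian_mul_inv hK hx)]
  simp

theorem norm_inv_invSqrtHessian (hR : IsSelfConcordantBarrier K R ν) (hK : IsActionSet K D)
    {x : Euc d} (hx : x ∈ interior K) (h : Euc d) :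
    ‖Matrix.toEuclideanLin (invSqrtHessian R x)⁻¹ h‖ = localNorm R x h := by
  have h1 : ‖Matrix.toEuclideanLin (invSqrtHessian R x)⁻¹ h‖ ^ 2 = localNorm R x h ^ 2 := by
    rw [← real_inner_self_eq_norm_sq, inner_inv_invSqrtHessian_comm,
      ← toEuclideanLin_mul_apply, hR.inv_invSqrtHessian_mul_self hK hx, inner_hessian,
      hR.localNorm_sq hx]
  exact (sq_eq_sq₀ (norm_nonneg _) (localNorm_nonneg _ _ _)).1 h1

theorem localNorm_invSqrtHessian (hR : IsSelfConcordantBarrier K R ν) (hK : IsActionSet K D)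
    {x : Euc d} (hx : x ∈ interior K) (u : Euc d) :
    localNorm R x (Matrix.toEuclideanLin (invSqrtHessian R x) u) = ‖u‖ := by
  rw [← hR.norm_inv_invSqrtHessian hK hx, hR.inv_invSqrtHessian_apply hK hx]

theorem playedPoint_mem (hR : IsSelfConcordantBarrier K R ν) (hK : IsActionSet K D) {x : Euc d}
    (hx : x ∈ interior K) (u : Metric.sphere (0 : Euc d) 1) : playedPoint R x u ∈ K :=
  hR.add_mem hK.isClosed hx (by
    rw [hR.localNorm_invSqrtHessian hK hx]; simp)

theorem norm_invSqrtHessian_le (hR : IsSelfConcordantBarrier K R ν) (hK : IsActionSet K D)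
    {x : Euc d} (hx : x ∈ interior K) (v : Euc d) :
    ‖Matrix.toEuclideanLin (invSqrtHessian R x) v‖ ≤ D * ‖v‖ := by
  rcases eq_or_ne v 0 with rfl | hv
  · simp
  have hn : 0 < ‖v‖ := norm_pos_iff.2 hv
  have hu : ‖(‖v‖⁻¹ • v)‖ = 1 := by rw [norm_smul, norm_inv, norm_norm, inv_mul_cancel₀ hn.ne']
  have h1 := hR.playedPoint_mem hK hx ⟨‖v‖⁻¹ • v, by simpa using hu⟩
  have h2 := hK.diam_le _ h1 _ (interior_subset hx)
  rw [playedPoint, add_sub_cancel_left, map_smul, norm_smul, norm_inv, norm_norm,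
    inv_mul_le_iff₀ hn] at h2
  linarith

/-! ### Measurability of the inverse square root of the Hessian -/

theorem continuousOn_hessian (hR : IsSelfConcordantBarrier K R ν) :
    ContinuousOn (hessian R) (interior K) := by
  refine continuousOn_pi.2 fun i => continuousOn_pi.2 fun j => ?_
  intro x hx
  have h1 : ContinuousAt (iteratedFDeriv ℝ 2 R) x :=
    ((hR.contDiffAt hx).differentiableAt_iteratedFDeriv (m := 2) (by norm_num)).continuousAt
  exact (((ContinuousMultilinearMap.apply ℝ (fun _ : Fin 2 => Euc d) ℝ
    ![EuclideanSpace.single i 1, EuclideanSpace.single j 1]).continuous.continuousAt).comp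
      h1).continuousWithinAt

/-- The entries of the inverse square root are measurable, as limits of polynomials in the
Hessian. -/
theorem measurable_invSqrtHessian (hR : IsSelfConcordantBarrier K R ν) (hK : IsActionSet K D)
    (i j : Fin d) : Measurable fun x : interior K => invSqrtHessian R x i j := by
  obtain ⟨p, hp⟩ := exists_polynomial_tendsto_rpow_neg_half
  have hc : Continuous fun x : interior K => hessian R x :=
    continuousOn_iff_continuous_domRestrict.1 hR.continuousOn_hessian
  refine measurable_of_tendsto_metrizable
    (f := fun k (x : interior K) => Polynomial.aeval (hessian R (x : Euc d)) (p k) i j) (fun k => ?_)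
    (tendsto_pi_nhds.2 fun x => ?_)
  · have h1 : Continuous fun x : interior K => Polynomial.aeval (hessian R (x : Euc d)) (p k) :=
      (p k).continuous_aeval.comp hc
    exact (h1.matrix_elem i j).measurable
  · have hpd := hR.posDef_hessian hK x.2
    have h1 := hpd.isHermitian.tendsto_cfc (f := fun k => (p k).eval)
      (g := fun s : ℝ => s ^ (-(1 / 2) : ℝ)) (fun s hs => hp s (hpd.spectrum_pos hs))
    simp only [cfc_polynomial _ _ hpd.isHermitian.isSelfAdjoint] at h1
    exact tendsto_pi_nhds.1 (tendsto_pi_nhds.1 h1 i) j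

theorem measurable_inv_invSqrtHessian (hR : IsSelfConcordantBarrier K R ν) (hK : IsActionSet K D)
    (i j : Fin d) : Measurable fun x : interior K => (invSqrtHessian R x)⁻¹ i j := by
  have e : ∀ x : interior K, (invSqrtHessian R x)⁻¹ = hessian R x * invSqrtHessian R x :=
    fun x => by
      rw [← hR.inv_invSqrtHessian_mul_self hK x.2, mul_assoc,
        _root_.mul_eq_one_comm.1 (hR.invSqrtHessian_mul_inv hK x.2), mul_one]
  have hc : Continuous fun x : interior K => hessian R x :=
    continuousOn_iff_continuous_domRestrict.1 hR.continuousOn_hessian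
  simp only [e, Matrix.mul_apply]
  exact Finset.measurable_sum _ fun k _ =>
    (hc.matrix_elem i k).measurable.mul (hR.measurable_invSqrtHessian hK k j)

end IsSelfConcordantBarrier

theorem measurable_toEuclideanLin {Ω : Type*} [MeasurableSpace Ω]
    {A : Ω → Matrix (Fin d) (Fin d) ℝ} {v : Ω → Euc d} (hA : ∀ i j, Measurable fun ω => A ω i j)
    (hv : Measurable v) : Measurable fun ω => Matrix.toEuclideanLin (A ω) (v ω) := by
  refine (PiLp.continuous_toLp 2 _).measurable.comp (measurable_pi_lambda _ fun i => ?_)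
  change Measurable fun ω => ∑ j, A ω i j * v ω j
  exact Finset.measurable_sum _ fun j _ =>
    (hA i j).mul ((EuclideanSpace.proj (𝕜 := ℝ) j).continuous.measurable.comp hv)

end Hessian

/-! ### Moments of the uniform distribution on the sphere -/

section Sphere

variable {d : ℕ}

/-- The action of a linear isometry on the unit sphere. -/
noncomputable def sphereMap (e : Euc d ≃ₗᵢ[ℝ] Euc d) (u : Metric.sphere (0 : Euc d) 1) :
    Metric.sphere (0 : Euc d) 1 :=
  ⟨e u, by simp⟩

theorem measurable_sphereMap (e : Euc d ≃ₗᵢ[ℝ] Euc d) : Measurable (sphereMap e) :=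
  (e.continuous.measurable.comp measurable_subtype_coe).subtype_mk

open scoped Pointwise in
theorem map_toSphere (e : Euc d ≃ₗᵢ[ℝ] Euc d) :
    (volume : Measure (Euc d)).toSphere.map (sphereMap e) =
      (volume : Measure (Euc d)).toSphere := by
  ext s hs
  rw [Measure.map_apply (measurable_sphereMap e) hs,
    Measure.toSphere_apply' _ (measurable_sphereMap e hs), Measure.toSphere_apply' _ hs]
  congr 1
  have h1 : Ioo (0 : ℝ) 1 • ((↑) '' (sphereMap e ⁻¹' s) : Set (Euc d)) =
      e.toMeasurableEquiv ⁻¹' (Ioo (0 : ℝ) 1 • ((↑) '' s)) := by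
    ext y
    simp only [Set.mem_smul, mem_preimage, mem_image]
    constructor
    · rintro ⟨r, hr, _, ⟨u, hu, rfl⟩, rfl⟩
      exact ⟨r, hr, _, ⟨_, hu, rfl⟩, by simp [sphereMap]⟩
    · rintro ⟨r, hr, _, ⟨u, hu, rfl⟩, h⟩
      refine ⟨r, hr, e.symm u, ⟨⟨e.symm u, by simp⟩, ?_, rfl⟩, ?_⟩
      · simpa [sphereMap] using hu
      · apply e.injective
        simpa using h
  rw [h1]
  exact e.measurePreserving.measure_preimage_equiv (f := e.toMeasurableEquiv) _

theorem map_uniformSphere (e : Euc d ≃ₗᵢ[ℝ] Euc d) :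
    (uniformSphere d).map (sphereMap e) = uniformSphere d := by
  rw [uniformSphere, Measure.map_smul, map_toSphere]

theorem integral_comp_sphereMap (e : Euc d ≃ₗᵢ[ℝ] Euc d) {φ : Metric.sphere (0 : Euc d) 1 → ℝ}
    (hφ : Measurable φ) :
    ∫ u, φ (sphereMap e u) ∂uniformSphere d = ∫ u, φ u ∂uniformSphere d := by
  conv_rhs => rw [← map_uniformSphere e]
  exact (integral_map (measurable_sphereMap e).aemeasurable hφ.aestronglyMeasurable).symm

theorem measurable_sphere_coord (i : Fin d) :
    Measurable fun u : Metric.sphere (0 : Euc d) 1 => (u : Euc d) i :=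
  (EuclideanSpace.proj (𝕜 := ℝ) i).continuous.measurable.comp measurable_subtype_coe

theorem abs_sphere_coord_le (u : Metric.sphere (0 : Euc d) 1) (i : Fin d) :
    |(u : Euc d) i| ≤ 1 := by
  have := PiLp.norm_apply_le (u : Euc d) i
  simpa using this

theorem integral_sphere_coord (i : Fin d) :
    ∫ u, (u : Euc d) i ∂uniformSphere d = 0 := by
  have := integral_comp_sphereMap (LinearIsometryEquiv.neg ℝ) (measurable_sphere_coord i)
  simp only [sphereMap, LinearIsometryEquiv.coe_neg, PiLp.neg_apply, integral_neg] at this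
  linarith

theorem integral_sphere_coord_mul_of_ne {i j : Fin d} (hij : i ≠ j) :
    ∫ u, (u : Euc d) i * (u : Euc d) j ∂uniformSphere d = 0 := by
  -- flip the sign of the `i`-th coordinate
  have := integral_comp_sphereMap
    (LinearIsometryEquiv.piLpCongrRight 2 fun k : Fin d =>
      if k = i then LinearIsometryEquiv.neg ℝ else LinearIsometryEquiv.refl ℝ ℝ)
    ((measurable_sphere_coord i).mul (measurable_sphere_coord j))
  simp [sphereMap, hij.symm, integral_neg] at this
  linarith

theorem integral_sphere_coord_sq_eq (i j : Fin d) :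
    ∫ u, (u : Euc d) i * (u : Euc d) i ∂uniformSphere d =
      ∫ u, (u : Euc d) j * (u : Euc d) j ∂uniformSphere d := by
  have := integral_comp_sphereMap
    (LinearIsometryEquiv.piLpCongrLeft 2 ℝ ℝ (Equiv.swap i j))
    ((measurable_sphere_coord j).mul (measurable_sphere_coord j))
  simpa [sphereMap, LinearIsometryEquiv.piLpCongrLeft_apply, Equiv.piCongrLeft'] using this

theorem integral_sphere_coord_mul [IsProbabilityMeasure (uniformSphere d)] (i j : Fin d) :
    ∫ u, (u : Euc d) i * (u : Euc d) j ∂uniformSphere d = if i = j then 1 / (d : ℝ) else 0 := by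
  split_ifs with h
  · subst h
    have hint : ∀ k : Fin d,
        Integrable (fun u : Metric.sphere (0 : Euc d) 1 => (u : Euc d) k * (u : Euc d) k)
          (uniformSphere d) := fun k =>
      Integrable.of_bound
        ((measurable_sphere_coord k).mul (measurable_sphere_coord k)).aestronglyMeasurable 1
        (Eventually.of_forall fun u => by
          rw [norm_mul, Real.norm_eq_abs]
          exact mul_le_one₀ (abs_sphere_coord_le u k) (abs_nonneg _) (abs_sphere_coord_le u k))
    have h1 : ∑ k : Fin d, ∫ u, (u : Euc d) k * (u : Euc d) k ∂uniformSphere d = 1 := by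
      rw [← integral_finsetSum _ fun k _ => hint k]
      have : ∀ u : Metric.sphere (0 : Euc d) 1, ∑ k, (u : Euc d) k * (u : Euc d) k = 1 := fun u => by
        have := EuclideanSpace.real_norm_sq_eq (u : Euc d)
        simpa [pow_two] using this.symm
      simp [this]
    rw [Finset.sum_congr rfl fun k _ => integral_sphere_coord_sq_eq k i] at h1
    simp only [Finset.sum_const, Finset.card_univ, Fintype.card_fin, nsmul_eq_mul] at h1
    exact eq_one_div_of_mul_eq_one_right h1
  · exact integral_sphere_coord_mul_of_ne h

end Sphere

section Direction

variable {d : ℕ} {Ω : Type*} {U : Ω → Metric.sphere (0 : Euc d) 1} {V W : Ω → Euc d}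
  {B : ℝ}

theorem measurable_coord {m : MeasurableSpace Ω} (hV : Measurable[m] V) (i : Fin d) :
    Measurable[m] fun ω => V ω i :=
  (EuclideanSpace.proj (𝕜 := ℝ) i).continuous.measurable.comp hV

variable {m : MeasurableSpace Ω} [mΩ : MeasurableSpace Ω] {P : Measure Ω} [IsProbabilityMeasure P]

theorem isProbabilityMeasure_uniformSphere (hU : Measurable U) (hlaw : P.map U = uniformSphere d) :
    IsProbabilityMeasure (uniformSphere d) :=
  hlaw ▸ Measure.isProbabilityMeasure_map hU.aemeasurable

/-- Conditionally on the past, a uniform direction has mean zero. -/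
theorem integral_inner_direction (hm : m ≤ mΩ) (hU : Measurable U)
    (hlaw : P.map U = uniformSphere d) (hind : Indep m (MeasurableSpace.comap U inferInstance) P)
    (hW : Measurable[m] W) (hWB : ∀ ω, ‖W ω‖ ≤ B) :
    ∫ ω, ⟪W ω, (U ω : Euc d)⟫_ℝ ∂P = 0 := by
  have hint : ∀ i, Integrable (fun ω => W ω i * (U ω : Euc d) i) P := fun i =>
    Integrable.of_bound (((measurable_coord hW i).mono hm le_rfl).mul
      ((measurable_sphere_coord i).comp hU)).aestronglyMeasurable (B * 1)
      (Eventually.of_forall fun ω => by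
        rw [norm_mul]
        exact mul_le_mul ((PiLp.norm_apply_le _ _).trans (hWB ω)) (abs_sphere_coord_le _ _)
          (norm_nonneg _) ((norm_nonneg _).trans (hWB ω)))
  have e : ∀ ω, ⟪W ω, (U ω : Euc d)⟫_ℝ = ∑ i, W ω i * (U ω : Euc d) i := fun ω => by
    simp [PiLp.inner_apply, mul_comm]
  simp only [e]
  rw [integral_finsetSum _ fun i _ => hint i]
  refine Finset.sum_eq_zero fun i _ => ?_
  have hind' : IndepFun (fun ω => W ω i) (fun ω => (U ω : Euc d) i) P := by
    refine (IndepFun_iff_Indep _ _ _).2 (indep_of_indep_of_le_left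
      (indep_of_indep_of_le_right hind ?_) (measurable_coord hW i).comap_le)
    exact ((measurable_sphere_coord i).comp (comap_measurable U)).comap_le
  rw [hind'.integral_fun_mul_eq_mul_integral
    ((measurable_coord hW i).mono hm le_rfl).aestronglyMeasurable
    ((measurable_sphere_coord i).comp hU).aestronglyMeasurable]
  have : ∫ ω, (U ω : Euc d) i ∂P = 0 := by
    rw [← integral_sphere_coord i, ← hlaw,
      integral_map hU.aemeasurable (measurable_sphere_coord i).aestronglyMeasurable]
  rw [this, mul_zero]

/-- Conditionally on the past, a uniform direction has covariance `1/d`. -/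
theorem integral_inner_mul_inner_direction (hm : m ≤ mΩ) (hU : Measurable U)
    (hlaw : P.map U = uniformSphere d) (hind : Indep m (MeasurableSpace.comap U inferInstance) P)
    (hV : Measurable[m] V) (hVB : ∀ ω, ‖V ω‖ ≤ B) (hW : Measurable[m] W) (hWB : ∀ ω, ‖W ω‖ ≤ B) :
    ∫ ω, ⟪V ω, (U ω : Euc d)⟫_ℝ * ⟪W ω, (U ω : Euc d)⟫_ℝ ∂P = (∫ ω, ⟪V ω, W ω⟫_ℝ ∂P) / d := by
  have := isProbabilityMeasure_uniformSphere hU hlaw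
  have hVW : ∀ i j, Measurable[m] fun ω => V ω i * W ω j := fun i j =>
    (measurable_coord hV i).mul (measurable_coord hW j)
  have hUU : ∀ i j, Measurable fun u : Metric.sphere (0 : Euc d) 1 => (u : Euc d) i * (u : Euc d) j :=
    fun i j => (measurable_sphere_coord i).mul (measurable_sphere_coord j)
  have hVWB : ∀ i j ω, ‖V ω i * W ω j‖ ≤ B * B := fun i j ω => by
    rw [norm_mul]
    exact mul_le_mul ((PiLp.norm_apply_le _ _).trans (hVB ω))
      ((PiLp.norm_apply_le _ _).trans (hWB ω)) (norm_nonneg _) ((norm_nonneg _).trans (hVB ω))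
  have hint : ∀ i j, Integrable
      (fun ω => (V ω i * W ω j) * ((U ω : Euc d) i * (U ω : Euc d) j)) P := fun i j =>
    Integrable.of_bound (((hVW i j).mono hm le_rfl).mul
      ((hUU i j).comp hU)).aestronglyMeasurable (B * B * 1)
      (Eventually.of_forall fun ω => by
        rw [norm_mul]
        refine mul_le_mul (hVWB i j ω) ?_ (norm_nonneg _) ((norm_nonneg _).trans (hVWB i j ω))
        rw [norm_mul]
        exact mul_le_one₀ (abs_sphere_coord_le _ _) (norm_nonneg _) (abs_sphere_coord_le _ _))
  have e : ∀ ω, ⟪V ω, (U ω : Euc d)⟫_ℝ * ⟪W ω, (U ω : Euc d)⟫_ℝ =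
      ∑ i, ∑ j, (V ω i * W ω j) * ((U ω : Euc d) i * (U ω : Euc d) j) := fun ω => by
    simp only [PiLp.inner_apply, RCLike.inner_apply, conj_trivial, Finset.sum_mul_sum]
    exact Finset.sum_congr rfl fun i _ => Finset.sum_congr rfl fun j _ => by ring
  simp only [e]
  rw [integral_finsetSum _ fun i _ => integrable_finsetSum _ fun j _ => hint i j]
  have hterm : ∀ i j, ∫ ω, (V ω i * W ω j) * ((U ω : Euc d) i * (U ω : Euc d) j) ∂P =
      if i = j then (∫ ω, V ω i * W ω j ∂P) * (1 / d) else 0 := fun i j => by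
    have hind' : IndepFun (fun ω => V ω i * W ω j) (fun ω => (U ω : Euc d) i * (U ω : Euc d) j) P := by
      refine (IndepFun_iff_Indep _ _ _).2 (indep_of_indep_of_le_left
        (indep_of_indep_of_le_right hind ?_) (hVW i j).comap_le)
      exact ((hUU i j).comp (comap_measurable U)).comap_le
    rw [hind'.integral_fun_mul_eq_mul_integral
      ((hVW i j).mono hm le_rfl).aestronglyMeasurable ((hUU i j).comp hU).aestronglyMeasurable]
    have h2 : ∫ ω, (U ω : Euc d) i * (U ω : Euc d) j ∂P = if i = j then 1 / (d : ℝ) else 0 := by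
      rw [← integral_sphere_coord_mul i j, ← hlaw,
        integral_map hU.aemeasurable (hUU i j).aestronglyMeasurable]
    rw [h2]
    split_ifs <;> simp
  have hsum : ∀ i, ∫ ω, ∑ j, (V ω i * W ω j) * ((U ω : Euc d) i * (U ω : Euc d) j) ∂P =
      (∫ ω, V ω i * W ω i ∂P) * (1 / d) := fun i => by
    rw [integral_finsetSum _ fun j _ => hint i j]
    simp only [hterm]
    simp
  simp only [hsum]
  have e2 : ∀ ω, ⟪V ω, W ω⟫_ℝ = ∑ i, V ω i * W ω i := fun ω => by
    simp [PiLp.inner_apply, mul_comm]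
  simp only [e2]
  rw [integral_finsetSum _ fun i _ => Integrable.of_bound
    ((hVW i i).mono hm le_rfl).aestronglyMeasurable (B * B) (Eventually.of_forall (hVWB i i)),
    ← Finset.sum_mul, mul_one_div]

end Direction

/-! ### Measurability of the run and independence of the past -/

section Round

variable {d : ℕ} {K : Set (Euc d)} {R : Euc d → ℝ} {ν D δ η : ℝ} {Ω : Type u}
  {X : Ω → Euc d} {V : Ω → Metric.sphere (0 : Euc d) 1}

namespace IsSelfConcordantBarrier

theorem measurable_invSqrtHessian_apply [MeasurableSpace Ω] (hR : IsSelfConcordantBarrier K R ν)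
    (hK : IsActionSet K D) (hX : Measurable X) (hXK : ∀ ω, X ω ∈ interior K) {v : Ω → Euc d}
    (hv : Measurable v) :
    Measurable fun ω => Matrix.toEuclideanLin (invSqrtHessian R (X ω)) (v ω) :=
  measurable_toEuclideanLin (A := fun ω => (invSqrtHessian R (X ω))) (fun i j =>
    Measurable.comp (g := fun z : interior K => (invSqrtHessian R z) i j)
      (f := fun ω => ⟨X ω, hXK ω⟩) (hR.measurable_invSqrtHessian hK i j) hX.subtype_mk) hv

theorem measurable_inv_invSqrtHessian_apply [MeasurableSpace Ω]
    (hR : IsSelfConcordantBarrier K R ν) (hK : IsActionSet K D) (hX : Measurable X)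
    (hXK : ∀ ω, X ω ∈ interior K) {v : Ω → Euc d} (hv : Measurable v) :
    Measurable fun ω => Matrix.toEuclideanLin (invSqrtHessian R (X ω))⁻¹ (v ω) :=
  measurable_toEuclideanLin (A := fun ω => (invSqrtHessian R (X ω))⁻¹) (fun i j =>
    Measurable.comp (g := fun z : interior K => (invSqrtHessian R z)⁻¹ i j)
      (f := fun ω => ⟨X ω, hXK ω⟩) (hR.measurable_inv_invSqrtHessian hK i j) hX.subtype_mk) hv

theorem measurable_playedPoint [MeasurableSpace Ω] (hR : IsSelfConcordantBarrier K R ν)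
    (hK : IsActionSet K D) (hX : Measurable X) (hXK : ∀ ω, X ω ∈ interior K) (hV : Measurable V) :
    Measurable fun ω => playedPoint R (X ω) (V ω) :=
  hX.add (hR.measurable_invSqrtHessian_apply hK hX hXK (measurable_subtype_coe.comp hV))

theorem measurable_loss [MeasurableSpace Ω] (hR : IsSelfConcordantBarrier K R ν)
    (hK : IsActionSet K D) (hX : Measurable X) (hXK : ∀ ω, X ω ∈ interior K) (hV : Measurable V)
    {l : Euc d → ℝ} (hl : Measurable (K.domRestrict l)) :
    Measurable fun ω => l (playedPoint R (X ω) (V ω)) :=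
  hl.comp ((hR.measurable_playedPoint hK hX hXK hV).subtype_mk
    (h := fun ω => hR.playedPoint_mem hK (hXK ω) (V ω)))

theorem measurable_gradEstimate [MeasurableSpace Ω] (hR : IsSelfConcordantBarrier K R ν)
    (hK : IsActionSet K D) (hX : Measurable X) (hXK : ∀ ω, X ω ∈ interior K) (hV : Measurable V)
    {l : Ω → ℝ} (hl : Measurable l) : Measurable fun ω => gradEstimate R (X ω) (V ω) (l ω) :=
  (hl.const_mul (d : ℝ)).smul
    (hR.measurable_inv_invSqrtHessian_apply hK hX hXK (measurable_subtype_coe.comp hV))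

end IsSelfConcordantBarrier

theorem inner_gradEstimate (R : Euc d → ℝ) (x : Euc d) (u : Metric.sphere (0 : Euc d) 1) (l : ℝ)
    (h : Euc d) :
    ⟪gradEstimate R x u l, h⟫_ℝ =
      d * l * ⟪Matrix.toEuclideanLin (invSqrtHessian R x)⁻¹ h, (u : Euc d)⟫_ℝ := by
  rw [gradEstimate, real_inner_smul_left, inner_inv_invSqrtHessian_comm, real_inner_comm]

/-- The estimators have dual local norm at most `d`. -/
theorem IsSelfConcordantBarrier.abs_inner_gradEstimate_le (hR : IsSelfConcordantBarrier K R ν)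
    (hK : IsActionSet K D) {x : Euc d} (hx : x ∈ interior K) (u : Metric.sphere (0 : Euc d) 1)
    {l : ℝ} (hl : |l| ≤ 1) (h : Euc d) :
    |⟪gradEstimate R x u l, h⟫_ℝ| ≤ d * localNorm R x h := by
  rw [inner_gradEstimate, abs_mul, abs_mul, Nat.abs_cast, mul_assoc]
  refine mul_le_mul_of_nonneg_left ?_ (Nat.cast_nonneg d)
  have h1 := abs_real_inner_le_norm (Matrix.toEuclideanLin (invSqrtHessian R x)⁻¹ h) (u : Euc d)
  rw [hR.norm_inv_invSqrtHessian hK hx, norm_eq_of_mem_sphere, mul_one] at h1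
  calc _ ≤ 1 * localNorm R x h := mul_le_mul hl h1 (abs_nonneg _) zero_le_one
    _ = _ := one_mul _

end Round

section Run

variable {d T : ℕ} {K : Set (Euc d)} {R : Euc d → ℝ} {ν D G C δ η : ℝ} {f : Fin T → Euc d → ℝ}
  {Ω : Type u} {U : Fin T → Ω → Metric.sphere (0 : Euc d) 1} {x : Fin T → Ω → Euc d}

/-- The information generated by the directions drawn before round `t`. -/
abbrev pastDirections (U : Fin T → Ω → Metric.sphere (0 : Euc d) 1) (t : Fin T) :
    MeasurableSpace Ω :=
  ⨆ τ ∈ Iio t, MeasurableSpace.comap (U τ) inferInstance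

theorem pastDirections_mono {s t : Fin T} (hst : s ≤ t) :
    pastDirections U s ≤ pastDirections U t :=
  biSup_mono fun _ h => lt_of_lt_of_le h hst

theorem measurable_pastDirections {s t : Fin T} (hst : s < t) :
    Measurable[pastDirections U t] (U s) :=
  Measurable.of_comap_le (le_biSup (fun τ => MeasurableSpace.comap (U τ) inferInstance)
    (show s ∈ Iio t from hst))

variable [mΩ : MeasurableSpace Ω] {P : Measure Ω}

/-- The estimator of a round is measurable with respect to any information that contains the
iterate and the direction of this round. -/
theorem measurable_scribbleGrad (hK : IsActionSet K D) (hR : IsSelfConcordantBarrier K R ν)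
    (hf : IsLossSequence K G C f) {t : Fin T} (hx : Measurable (x t))
    (hxi : ∀ ω, x t ω ∈ interior K) (hU : Measurable (U t)) :
    Measurable (scribbleGrad R f U x t) :=
  hR.measurable_gradEstimate hK hx hxi hU (hR.measurable_loss hK hx hxi hU (hf.measurable t))

namespace IsScribbleRun

theorem pastDirections_le (h : IsScribbleRun P K R η δ f U x) (t : Fin T) :
    pastDirections U t ≤ mΩ :=
  iSup₂_le fun τ _ => (h.measurable_dir τ).comap_le

theorem indep_pastDirections (h : IsScribbleRun P K R η δ f U x) (t : Fin T) :
    Indep (pastDirections U t) (MeasurableSpace.comap (U t) inferInstance) P := by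
  have h1 := indep_iSup_of_disjoint (fun τ => (h.measurable_dir τ).comap_le)
    ((iIndepFun_iff_iIndep _ _ _).1 h.indep_dir) (S := Iio t) (T := {t}) (by simp)
  simpa [pastDirections] using h1

theorem mem_interior (h : IsScribbleRun P K R η δ f U x) (hK : IsActionSet K D) (hδ0 : 0 < δ)
    (hδ1 : δ < 1) (t : Fin T) (ω : Ω) : x t ω ∈ interior K :=
  hK.shrunk_subset_interior hδ0 hδ1 (h.mem_shrunk t ω)

theorem play_mem (h : IsScribbleRun P K R η δ f U x) (hK : IsActionSet K D)
    (hR : IsSelfConcordantBarrier K R ν) (hδ0 : 0 < δ) (hδ1 : δ < 1) (t : Fin T) (ω : Ω) :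
    scribblePlay R U x t ω ∈ K :=
  hR.playedPoint_mem hK (h.mem_interior hK hδ0 hδ1 t ω) _

/-- The iterate of round `t` is a function of the earlier directions: it is the unique regularized
leader, which depends continuously on the earlier estimators. -/
theorem measurable_iterate (h : IsScribbleRun P K R η δ f U x) (hK : IsActionSet K D)
    (hR : IsSelfConcordantBarrier K R ν) (hf : IsLossSequence K G C f) (hδ0 : 0 < δ) (hδ1 : δ < 1)
    (t : Fin T) : Measurable[pastDirections U t] (x t) := by
  obtain ⟨M, hMc, hM⟩ := hR.exists_leader hK hδ0 hδ1
  induction t using WellFoundedLT.induction with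
  | ind t ih =>
    have hx : x t = fun ω => M (η • ∑ τ ∈ Finset.Iio t, scribbleGrad R f U x τ ω) := by
      funext ω
      refine (hM _).2.2 _ (h.mem_shrunk t ω) ?_
      have := h.isMinOn t ω
      simpa only [real_inner_smul_left, sum_inner] using this
    rw [hx]
    refine hMc.measurable.comp (Measurable.const_smul (Finset.measurable_fun_sum _ fun τ hτ => ?_) η)
    have hlt : τ < t := Finset.mem_Iio.1 hτ
    exact measurable_scribbleGrad (mΩ := pastDirections U t) hK hR hf
      ((ih τ hlt).mono (pastDirections_mono hlt.le) le_rfl) (h.mem_interior hK hδ0 hδ1 τ)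
      (measurable_pastDirections hlt)

/-! ### Expected regret -/

theorem measurable_loss (h : IsScribbleRun P K R η δ f U x) (hK : IsActionSet K D)
    (hR : IsSelfConcordantBarrier K R ν) (hf : IsLossSequence K G C f) (hδ0 : 0 < δ) (hδ1 : δ < 1)
    (t : Fin T) : Measurable fun ω => f t (scribblePlay R U x t ω) :=
  hR.measurable_loss hK ((h.measurable_iterate hK hR hf hδ0 hδ1 t).mono
    (h.pastDirections_le t) le_rfl) (h.mem_interior hK hδ0 hδ1 t) (h.measurable_dir t)
    (hf.measurable t)

theorem integrable_loss [IsProbabilityMeasure P] (h : IsScribbleRun P K R η δ f U x)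
    (hK : IsActionSet K D) (hR : IsSelfConcordantBarrier K R ν) (hf : IsLossSequence K G C f)
    (hδ0 : 0 < δ) (hδ1 : δ < 1) (t : Fin T) :
    Integrable (fun ω => f t (scribblePlay R U x t ω)) P :=
  Integrable.of_bound (h.measurable_loss hK hR hf hδ0 hδ1 t).aestronglyMeasurable 1
    (Eventually.of_forall fun ω => hf.abs_le_one t _ (h.play_mem hK hR hδ0 hδ1 t ω))

/-- The decomposition of the expected loss of a round, for an arbitrary comparator `y` and an
arbitrary linear part `θ`: the estimated linear regret, and the contribution of the deviation
`f_t(y_t) - θᵀ y_t`, both directly and through the bias of the estimator. -/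
theorem integral_loss_eq [IsProbabilityMeasure P] (h : IsScribbleRun P K R η δ f U x)
    (hK : IsActionSet K D) (hR : IsSelfConcordantBarrier K R ν) (hν : 0 < ν)
    (hf : IsLossSequence K G C f) (hδ0 : 0 < δ) (hδ1 : δ < 1) (hd : 0 < d) (t : Fin T)
    (θ : Euc d) {y : Euc d} (hy : y ∈ shrunk K δ) :
    Integrable (fun ω => ⟪scribbleGrad R f U x t ω, x t ω - y⟫_ℝ +
      (f t (scribblePlay R U x t ω) - ⟪θ, scribblePlay R U x t ω⟫_ℝ) *
        (1 - d * ⟪Matrix.toEuclideanLin (invSqrtHessian R (x t ω))⁻¹ (x t ω - y),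
          (U t ω : Euc d)⟫_ℝ)) P ∧
    ∫ ω, f t (scribblePlay R U x t ω) ∂P = ⟪θ, y⟫_ℝ +
      ∫ ω, (⟪scribbleGrad R f U x t ω, x t ω - y⟫_ℝ +
      (f t (scribblePlay R U x t ω) - ⟪θ, scribblePlay R U x t ω⟫_ℝ) *
        (1 - d * ⟪Matrix.toEuclideanLin (invSqrtHessian R (x t ω))⁻¹ (x t ω - y),
          (U t ω : Euc d)⟫_ℝ)) ∂P := by
  have hm := h.pastDirections_le t
  have hxi := h.mem_interior hK hδ0 hδ1 t
  have hxm := h.measurable_iterate hK hR hf hδ0 hδ1 t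
  set V : Ω → Euc d := fun ω => Matrix.toEuclideanLin (invSqrtHessian R (x t ω)) θ with hV
  set W : Ω → Euc d := fun ω => Matrix.toEuclideanLin (invSqrtHessian R (x t ω))⁻¹ (x t ω - y)
    with hW
  set ρ := 2 * (ν + 2 * √ν) * ((1 - δ) / δ) with hρ
  have hρ0 : 0 ≤ ρ := (localNorm_nonneg R y (y - y)).trans
    (hR.localNorm_sub_le_of_mem_shrunk hK hν hδ0 hδ1 hy hy)
  have hD0 := hK.diam_nonneg
  have hVm : Measurable[pastDirections U t] V :=
    @IsSelfConcordantBarrier.measurable_invSqrtHessian_apply d K R ν D Ω (x t) (pastDirections U t)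
      hR hK hxm hxi _ measurable_const
  have hWm : Measurable[pastDirections U t] W :=
    @IsSelfConcordantBarrier.measurable_inv_invSqrtHessian_apply d K R ν D Ω (x t)
      (pastDirections U t) hR hK hxm hxi _ (hxm.sub_const y)
  have hVB : ∀ ω, ‖V ω‖ ≤ D * ‖θ‖ := fun ω => hR.norm_invSqrtHessian_le hK (hxi ω) θ
  have hWB : ∀ ω, ‖W ω‖ ≤ ρ := fun ω => by
    have h1 := hR.localNorm_sub_le_of_mem_shrunk hK hν hδ0 hδ1 (h.mem_shrunk t ω) hy
    have h2 := localNorm_smul R (x t ω) (y - x t ω) (-1)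
    rw [neg_one_smul, neg_sub, abs_neg, abs_one, one_mul] at h2
    rw [hW, hR.norm_inv_invSqrtHessian hK (hxi ω), h2]
    exact h1
  have hp : Measurable[pastDirections U t] fun ω => ⟪θ, x t ω⟫_ℝ := hxm.const_inner
  have hpB : ∀ ω, |⟪θ, x t ω⟫_ℝ| ≤ ‖θ‖ * D := fun ω => by
    refine (abs_real_inner_le_norm _ _).trans (mul_le_mul_of_nonneg_left ?_ (norm_nonneg _))
    have := hK.norm_le (interior_subset (hxi ω))
    linarith [norm_nonneg (x t ω)]
  have hpW : Measurable[pastDirections U t] fun ω => ⟪θ, x t ω⟫_ℝ • W ω := hp.smul hWm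
  have hpWB : ∀ ω, ‖⟪θ, x t ω⟫_ℝ • W ω‖ ≤ ‖θ‖ * D * ρ := fun ω => by
    rw [norm_smul]
    exact mul_le_mul (hpB ω) (hWB ω) (norm_nonneg _) (by positivity)
  have hU := h.measurable_dir t
  have hUc : Measurable fun ω => (U t ω : Euc d) := measurable_subtype_coe.comp hU
  have hi1 := integral_inner_direction hm hU (h.law_dir t) (h.indep_pastDirections t) hVm hVB
  have hi2 := integral_inner_direction hm hU (h.law_dir t) (h.indep_pastDirections t) hpW hpWB
  have hi3 := integral_inner_mul_inner_direction hm hU (h.law_dir t) (h.indep_pastDirections t)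
    (B := max (D * ‖θ‖) ρ) hVm (fun ω => (hVB ω).trans (le_max_left _ _)) hWm
    (fun ω => (hWB ω).trans (le_max_right _ _))
  have hVW : ∀ ω, ⟪V ω, W ω⟫_ℝ = ⟪θ, x t ω⟫_ℝ - ⟪θ, y⟫_ℝ := fun ω => by
    simp only [hV, hW]
    rw [inner_invSqrtHessian_comm, hR.invSqrtHessian_inv_apply hK (hxi ω), inner_sub_right]
  have hbound : ∀ {Z : Ω → Euc d} {B : ℝ}, (∀ ω, ‖Z ω‖ ≤ B) → ∀ ω, ‖⟪Z ω, (U t ω : Euc d)⟫_ℝ‖ ≤ B :=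
    fun {Z B} hZ ω => (norm_inner_le_norm _ _).trans (by
      rw [norm_eq_of_mem_sphere, mul_one]; exact hZ ω)
  have int_p : Integrable (fun ω => ⟪θ, x t ω⟫_ℝ) P :=
    Integrable.of_bound (hp.mono hm le_rfl).aestronglyMeasurable _ (Eventually.of_forall hpB)
  have int_b : Integrable (fun ω => ⟪V ω, (U t ω : Euc d)⟫_ℝ) P :=
    Integrable.of_bound ((hVm.mono hm le_rfl).inner hUc).aestronglyMeasurable _
      (Eventually.of_forall (hbound hVB))
  have int_pa : Integrable (fun ω => ⟪⟪θ, x t ω⟫_ℝ • W ω, (U t ω : Euc d)⟫_ℝ) P :=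
    Integrable.of_bound ((hpW.mono hm le_rfl).inner hUc).aestronglyMeasurable _
      (Eventually.of_forall (hbound hpWB))
  have int_ba : Integrable (fun ω => ⟪V ω, (U t ω : Euc d)⟫_ℝ * ⟪W ω, (U t ω : Euc d)⟫_ℝ) P :=
    Integrable.of_bound (((hVm.mono hm le_rfl).inner hUc).mul
      ((hWm.mono hm le_rfl).inner hUc)).aestronglyMeasurable (D * ‖θ‖ * ρ)
      (Eventually.of_forall fun ω => by
        rw [norm_mul]
        exact mul_le_mul (hbound hVB ω) (hbound hWB ω) (norm_nonneg _) (by positivity))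
  have int_F := h.integrable_loss hK hR hf hδ0 hδ1 t
  have e : ∀ ω, ⟪scribbleGrad R f U x t ω, x t ω - y⟫_ℝ +
      (f t (scribblePlay R U x t ω) - ⟪θ, scribblePlay R U x t ω⟫_ℝ) *
        (1 - d * ⟪Matrix.toEuclideanLin (invSqrtHessian R (x t ω))⁻¹ (x t ω - y),
          (U t ω : Euc d)⟫_ℝ) =
      f t (scribblePlay R U x t ω) - ⟪θ, x t ω⟫_ℝ - ⟪V ω, (U t ω : Euc d)⟫_ℝ
        + d * ⟪⟪θ, x t ω⟫_ℝ • W ω, (U t ω : Euc d)⟫_ℝ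
        + d * (⟪V ω, (U t ω : Euc d)⟫_ℝ * ⟪W ω, (U t ω : Euc d)⟫_ℝ) := fun ω => by
    have e1 : ⟪θ, scribblePlay R U x t ω⟫_ℝ = ⟪θ, x t ω⟫_ℝ + ⟪V ω, (U t ω : Euc d)⟫_ℝ := by
      rw [scribblePlay, playedPoint, inner_add_right, hV, inner_invSqrtHessian_comm]
    rw [scribbleGrad, inner_gradEstimate, e1, real_inner_smul_left, hW]
    ring
  simp only [e]
  have s1 : Integrable (fun ω => f t (scribblePlay R U x t ω) - ⟪θ, x t ω⟫_ℝ) P := int_F.sub int_p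
  have s2 : Integrable (fun ω => f t (scribblePlay R U x t ω) - ⟪θ, x t ω⟫_ℝ
      - ⟪V ω, (U t ω : Euc d)⟫_ℝ) P := s1.sub int_b
  have s3 : Integrable (fun ω => f t (scribblePlay R U x t ω) - ⟪θ, x t ω⟫_ℝ
      - ⟪V ω, (U t ω : Euc d)⟫_ℝ + d * ⟪⟪θ, x t ω⟫_ℝ • W ω, (U t ω : Euc d)⟫_ℝ) P :=
    s2.add (int_pa.const_mul _)
  refine ⟨s3.add (int_ba.const_mul _), ?_⟩
  have hd' : (d : ℝ) ≠ 0 := by exact_mod_cast hd.ne'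
  rw [integral_add s3 (int_ba.const_mul _), integral_add s2 (int_pa.const_mul _),
    integral_sub s1 int_b, integral_sub int_F int_p, integral_const_mul,
    integral_const_mul, hi1, hi2, hi3]
  simp only [hVW]
  rw [integral_sub int_p (integrable_const _)]
  simp
  field_simp
  ring

end IsScribbleRun

end Run

section Regret

variable {d T : ℕ} {K : Set (Euc d)} {R : Euc d → ℝ} {ν D G C δ η : ℝ} {f : Fin T → Euc d → ℝ}
  {Ω : Type u} [mΩ : MeasurableSpace Ω] {P : Measure Ω}
  {U : Fin T → Ω → Metric.sphere (0 : Euc d) 1} {x : Fin T → Ω → Euc d}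

theorem IsLossSequence.deviation_nonneg (hf : IsLossSequence K G C f) (hK : IsActionSet K D) :
    0 ≤ C := by
  obtain ⟨θ, -, h⟩ := hf.approxLinear
  exact (Finset.sum_nonneg fun t _ => abs_nonneg _).trans (h (fun _ => 0) fun _ => hK.zero_mem)

theorem IsLossSequence.slope_bound_nonneg (hf : IsLossSequence K G C f) (hT : 0 < T) : 0 ≤ G := by
  obtain ⟨θ, h, -⟩ := hf.approxLinear
  exact (norm_nonneg _).trans (h ⟨0, hT⟩)

theorem learningRate_pos (hd : 0 < d) (hT : 0 < T) (hν : 0 < ν) (hδ0 : 0 < δ) (hδ1 : δ < 1) :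
    0 < learningRate d T ν δ := by
  have hL : 0 < Real.log (1 / δ) := Real.log_pos ((one_lt_div hδ0).2 hδ1)
  unfold learningRate
  positivity

/-- Expected regret against a fixed comparator when the steps are short, `η d ≤ 1/2`. The iterates
compete with `(1 - δ)² z`, at the cost `(2δ - δ²) ‖θ_t‖ ‖z‖ ≤ δ G D` per round. -/
theorem IsScribbleRun.sum_integral_loss_sub_le [IsProbabilityMeasure P]
    (h : IsScribbleRun P K R η δ f U x) (hK : IsActionSet K D)
    (hR : IsSelfConcordantBarrier K R ν) (hν : 0 < ν) (hf : IsLossSequence K G C f) (hδ0 : 0 < δ)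
    (hδ1 : δ < 1) (hd : 0 < d) (hη : 0 < η) (hq : η * d ≤ 1 / 2) {z : Euc d} (hz : z ∈ K) :
    ∑ t, ∫ ω, f t (scribblePlay R U x t ω) ∂P - ∑ t, f t z ≤
      (2 * η * d ^ 2 * T + ν * Real.log (1 / δ) / η)
        + 2 * C * d * (ν + 2 * √ν) * ((1 - δ) / δ) + δ * G * D * T + 2 * C := by
  obtain ⟨θ, hθ, hC⟩ := hf.approxLinear
  have h1δ : 0 < 1 - δ := by linarith
  set y : Euc d := (1 - δ) ^ 2 • z with hy_def
  have hy : y ∈ shrunk K δ := by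
    have h0 : (1 - δ) • z ∈ K := by
      have := hK.combo_mem hz hz (a := 1 - δ) (b := 0) (by
        rw [abs_zero, abs_of_pos h1δ]; linarith)
      simpa using this
    have := smul_mem_shrunk hδ1 h0
    rwa [smul_smul, ← pow_two] at this
  set ρ := 2 * (ν + 2 * √ν) * ((1 - δ) / δ) with hρ
  have hρ0 : 0 ≤ ρ := (localNorm_nonneg R y (y - y)).trans
    (hR.localNorm_sub_le_of_mem_shrunk hK hν hδ0 hδ1 hy hy)
  set Z : Fin T → Ω → ℝ := fun t ω => ⟪scribbleGrad R f U x t ω, x t ω - y⟫_ℝ +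
      (f t (scribblePlay R U x t ω) - ⟪θ t, scribblePlay R U x t ω⟫_ℝ) *
        (1 - d * ⟪Matrix.toEuclideanLin (invSqrtHessian R (x t ω))⁻¹ (x t ω - y),
          (U t ω : Euc d)⟫_ℝ) with hZ
  have hdec : ∀ t, Integrable (Z t) P ∧ ∫ ω, f t (scribblePlay R U x t ω) ∂P =
      ⟪θ t, y⟫_ℝ + ∫ ω, Z t ω ∂P := fun t =>
    h.integral_loss_eq hK hR hν hf hδ0 hδ1 hd t (θ t) hy
  -- the regret against the estimated linear losses and the total deviation are bounded pointwise
  have hpt : ∀ ω, ∑ t, Z t ω ≤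
      (2 * η * d ^ 2 * T + ν * Real.log (1 / δ) / η) + C * (1 + d * ρ) := by
    intro ω
    have hxi := fun t => h.mem_interior hK hδ0 hδ1 t ω
    have h1 := hR.leader_regret hK hδ0 hδ1 hη (Nat.cast_nonneg d) hq
      (g := fun t => scribbleGrad R f U x t ω) (x := fun t => x t ω)
      (fun t => h.mem_shrunk t ω) (fun t => h.isMinOn t ω)
      (fun t v => hR.abs_inner_gradEstimate_le hK (hxi t) _
        (hf.abs_le_one t _ (h.play_mem hK hR hδ0 hδ1 t ω)) v) hy
      (fun w hw => hR.sub_le_log_of_mem_shrunk hK hν hδ0 hδ1 hw hz)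
    have h2 : ∀ t, (f t (scribblePlay R U x t ω) - ⟪θ t, scribblePlay R U x t ω⟫_ℝ) *
        (1 - d * ⟪Matrix.toEuclideanLin (invSqrtHessian R (x t ω))⁻¹ (x t ω - y),
          (U t ω : Euc d)⟫_ℝ) ≤
        |f t (scribblePlay R U x t ω) - ⟪θ t, scribblePlay R U x t ω⟫_ℝ| * (1 + d * ρ) := by
      intro t
      refine (le_abs_self _).trans ?_
      rw [abs_mul]
      refine mul_le_mul_of_nonneg_left ?_ (abs_nonneg _)
      have h3 := abs_real_inner_le_norm
        (Matrix.toEuclideanLin (invSqrtHessian R (x t ω))⁻¹ (x t ω - y)) (U t ω : Euc d)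
      have h4 := hR.localNorm_sub_le_of_mem_shrunk hK hν hδ0 hδ1 (h.mem_shrunk t ω) hy
      have h5 := localNorm_smul R (x t ω) (y - x t ω) (-1)
      rw [neg_one_smul, neg_sub, abs_neg, abs_one, one_mul] at h5
      rw [hR.norm_inv_invSqrtHessian hK (hxi t), norm_eq_of_mem_sphere, mul_one, h5] at h3
      have h6 := mul_le_mul_of_nonneg_left (h3.trans h4) (Nat.cast_nonneg (α := ℝ) d)
      calc _ ≤ |(1 : ℝ)| + |d * ⟪Matrix.toEuclideanLin (invSqrtHessian R (x t ω))⁻¹ (x t ω - y),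
          (U t ω : Euc d)⟫_ℝ| := abs_sub _ _
        _ ≤ _ := by rw [abs_one, abs_mul, Nat.abs_cast]; linarith
    have h3 := hC (fun t => scribblePlay R U x t ω) fun t => h.play_mem hK hR hδ0 hδ1 t ω
    have h4 := Finset.sum_le_sum fun t (_ : t ∈ Finset.univ) => h2 t
    rw [← Finset.sum_mul] at h4
    have h5 := mul_le_mul_of_nonneg_right h3 (by positivity : 0 ≤ 1 + d * ρ)
    simp only [hZ, Finset.sum_add_distrib]
    linarith
  have hint : ∑ t, ∫ ω, Z t ω ∂P ≤
      (2 * η * d ^ 2 * T + ν * Real.log (1 / δ) / η) + C * (1 + d * ρ) := by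
    rw [← integral_finsetSum _ fun t _ => (hdec t).1]
    refine (integral_mono (integrable_finsetSum _ fun t _ => (hdec t).1)
      (integrable_const _) hpt).trans_eq ?_
    simp
  have hcomp : ∀ t, ⟪θ t, y⟫_ℝ - ⟪θ t, z⟫_ℝ ≤ δ * G * D := fun t => by
    have e : ⟪θ t, y⟫_ℝ - ⟪θ t, z⟫_ℝ = (2 * δ - δ ^ 2) * (-⟪θ t, z⟫_ℝ) := by
      rw [hy_def, real_inner_smul_right]; ring
    have h1 : -⟪θ t, z⟫_ℝ ≤ G * (D / 2) := by
      refine (neg_le_abs _).trans ((abs_real_inner_le_norm _ _).trans ?_)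
      have := hK.norm_le hz
      exact mul_le_mul (hθ t) (by linarith) (norm_nonneg _) ((norm_nonneg _).trans (hθ t))
    have h2 : 0 ≤ G * (D / 2) :=
      mul_nonneg ((norm_nonneg _).trans (hθ t)) (by linarith [hK.diam_nonneg])
    rw [e]
    have h3 : 0 ≤ 2 * δ - δ ^ 2 := by nlinarith
    nlinarith [mul_le_mul_of_nonneg_left h1 h3, mul_nonneg (sq_nonneg δ) h2]
  have hdev := hC (fun _ => z) fun _ => hz
  have h1 : ∑ t, ∫ ω, f t (scribblePlay R U x t ω) ∂P = ∑ t, ⟪θ t, y⟫_ℝ + ∑ t, ∫ ω, Z t ω ∂P := by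
    rw [← Finset.sum_add_distrib]
    exact Finset.sum_congr rfl fun t _ => (hdec t).2
  have h2 : ∑ t, ⟪θ t, y⟫_ℝ - ∑ t, f t z ≤ δ * G * D * T + C := by
    have h3 : ∀ t, ⟪θ t, y⟫_ℝ - f t z ≤ δ * G * D + |f t z - ⟪θ t, z⟫_ℝ| := fun t => by
      have := neg_le_abs (f t z - ⟪θ t, z⟫_ℝ)
      linarith [hcomp t]
    rw [← Finset.sum_sub_distrib]
    refine (Finset.sum_le_sum fun t _ => h3 t).trans ?_
    rw [Finset.sum_add_distrib]
    simp only [Finset.sum_const, Finset.card_univ, Fintype.card_fin, nsmul_eq_mul]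
    linarith
  have e : C * (1 + d * ρ) = C + 2 * C * d * (ν + 2 * √ν) * ((1 - δ) / δ) := by rw [hρ]; ring
  rw [h1]
  linarith

/-- The regret bound of SCRiBLe. For long steps, `η d > 1/2`, its first term exceeds the trivial
bound `2 T`. -/
theorem IsScribbleRun.regret_bound [IsProbabilityMeasure P] (hd : 0 < d) (hT : 0 < T)
    (hK : IsActionSet K D) (hν : 0 < ν) (hR : IsSelfConcordantBarrier K R ν)
    (hf : IsLossSequence K G C f) (hδ0 : 0 < δ) (hδ1 : δ < 1)
    (h : IsScribbleRun P K R (learningRate d T ν δ) δ f U x) :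
    Integrable (fun ω => regret K f (fun t => scribblePlay R U x t ω)) P ∧
      ∫ ω, regret K f (fun t => scribblePlay R U x t ω) ∂P ≤
        4 * d * √(ν * T * Real.log (1 / δ))
          + 2 * C * d * (ν + 2 * √ν) * ((1 - δ) / δ) + δ * G * D * T + 2 * C := by
  have hint : ∀ t, Integrable (fun ω => f t (scribblePlay R U x t ω)) P :=
    h.integrable_loss hK hR hf hδ0 hδ1
  have hsum : Integrable (fun ω => ∑ t, f t (scribblePlay R U x t ω)) P :=
    integrable_finsetSum _ fun t _ => hint t
  refine ⟨hsum.sub (integrable_const _), ?_⟩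
  set L := Real.log (1 / δ) with hL_def
  have hL : 0 < L := Real.log_pos ((one_lt_div hδ0).2 hδ1)
  set B := 4 * d * √(ν * T * L) + 2 * C * d * (ν + 2 * √ν) * ((1 - δ) / δ)
    + δ * G * D * T + 2 * C with hB
  have key : ∀ z ∈ K, ∑ t, ∫ ω, f t (scribblePlay R U x t ω) ∂P - ∑ t, f t z ≤ B := by
    intro z hz
    have hT' : (0 : ℝ) < T := by exact_mod_cast hT
    have hd' : (1 : ℝ) ≤ d := by exact_mod_cast hd
    set a := √(ν * L) with ha
    set s := √(T : ℝ) with hs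
    have ha0 : 0 < a := Real.sqrt_pos.2 (by positivity)
    have hs0 : 0 < s := Real.sqrt_pos.2 hT'
    have ha2 : a ^ 2 = ν * L := Real.sq_sqrt (by positivity)
    have hs2 : s ^ 2 = T := Real.sq_sqrt hT'.le
    have has : √(ν * T * L) = a * s := by
      rw [ha, hs, ← Real.sqrt_mul (by positivity)]; congr 1; ring
    have hη : learningRate d T ν δ = a / (2 * d * s) := rfl
    have hηd : learningRate d T ν δ * d = a / (2 * s) := by rw [hη]; field_simp
    rcases le_or_gt a s with hle | hlt
    · have h1 := h.sum_integral_loss_sub_le hK hR hν hf hδ0 hδ1 hd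
        (learningRate_pos hd hT hν hδ0 hδ1) (by
          rw [hηd, div_le_iff₀ (by positivity)]; linarith) hz
      have e : 2 * learningRate d T ν δ * d ^ 2 * T + ν * L / learningRate d T ν δ
          = 3 * (d * (a * s)) := by
        rw [hη, ← ha2, ← hs2]; field_simp; norm_num
      rw [← hL_def, e] at h1
      rw [hB, has]
      have : 0 ≤ d * (a * s) := by positivity
      linarith
    · have h1 : ∀ t, ∫ ω, f t (scribblePlay R U x t ω) ∂P - f t z ≤ 2 := fun t => by
        have h2 : ∫ ω, f t (scribblePlay R U x t ω) ∂P ≤ ∫ _ω, (1 : ℝ) ∂P :=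
          integral_mono (hint t) (integrable_const _) fun ω =>
            (abs_le.1 (hf.abs_le_one t _ (h.play_mem hK hR hδ0 hδ1 t ω))).2
        have h3 := (abs_le.1 (hf.abs_le_one t z hz)).1
        simp only [integral_const, probReal_univ, smul_eq_mul, mul_one] at h2
        linarith
      have h2 := Finset.sum_le_sum fun t (_ : t ∈ Finset.univ) => h1 t
      rw [Finset.sum_sub_distrib] at h2
      simp only [Finset.sum_const, Finset.card_univ, Fintype.card_fin, nsmul_eq_mul] at h2
      have hC := hf.deviation_nonneg hK
      have hG := hf.slope_bound_nonneg hT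
      have hD := hK.diam_nonneg
      have h3 : 0 ≤ 2 * C * d * (ν + 2 * √ν) * ((1 - δ) / δ) :=
        mul_nonneg (by positivity) (div_nonneg (by linarith) hδ0.le)
      have h4 : 0 ≤ δ * G * D * T := by positivity
      have h5 : (T : ℝ) ≤ d * (a * s) := by
        rw [← hs2]
        nlinarith [mul_pos ha0 hs0]
      rw [hB, has]
      linarith
  have hne : Nonempty K := ⟨⟨0, hK.zero_mem⟩⟩
  have hinf : ∑ t, ∫ ω, f t (scribblePlay R U x t ω) ∂P - B ≤ ⨅ z : K, ∑ t, f t z :=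
    le_ciInf fun z => by linarith [key z z.2]
  unfold regret
  rw [integral_sub hsum (integrable_const _), integral_finsetSum _ fun t _ => hint t]
  simp only [integral_const, probReal_univ, one_smul]
  linarith

end Regret

/-! ### The tuned rates -/

theorem half_le_sqrt_log_of_three_halves_le {a : ℝ} (ha : 3 / 2 ≤ a) : 1 / 2 ≤ √(Real.log a) := by
  refine Real.le_sqrt_of_sq_le ?_
  have h1 : (1 - a⁻¹) ≤ Real.log a := Real.one_sub_inv_le_log_of_pos (by linarith)
  have h2 : a⁻¹ ≤ (3 / 2)⁻¹ := inv_anti₀ (by norm_num) ha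
  norm_num at h2 ⊢
  linarith

/-- The factor `c(ν, G, D)` of the tuned rates. The logarithms under the root are at least `1/4`, so
that doubled constants absorb the terms of the regret bound without a logarithm. -/
noncomputable def rateFactor (ν G D : ℝ) : ℝ := 8 * √ν + 4 * (ν + 2 * √ν) + 2 * (G * D) + 4

theorem tuned_bound {d T : ℕ} (hd : 0 < d) (hT : 0 < T) {ν D G C δ : ℝ} (hν : 0 < ν) (hG : 0 ≤ G)
    (hD : 0 ≤ D) (hC : 0 < C) (hCT : C / T ≤ 2 / 3) (hδ : δ = √(C / T)) :
    4 * d * √(ν * T * Real.log (1 / δ)) + 2 * C * d * (ν + 2 * √ν) * ((1 - δ) / δ)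
        + δ * G * D * T + 2 * C ≤
      rateFactor ν G D * √(Real.log (T / C)) * (d * √T + d * √(T * C) + d * C) := by
  have hT' : (0 : ℝ) < T := by exact_mod_cast hT
  have hd' : (1 : ℝ) ≤ d := by exact_mod_cast hd
  set l := √(Real.log (T / C)) with hl
  have hTC : 3 / 2 ≤ T / C := by
    rw [div_le_iff₀ hT'] at hCT
    rw [le_div_iff₀ hC]; linarith
  have hl2 : 1 / 2 ≤ l := half_le_sqrt_log_of_three_halves_le hTC
  have hlog : 0 ≤ Real.log (T / C) := Real.log_nonneg (by linarith)
  have hsT : 0 < √(T : ℝ) := Real.sqrt_pos.2 hT'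
  have hsC : 0 < √C := Real.sqrt_pos.2 hC
  have hT2 : √(T : ℝ) ^ 2 = T := Real.sq_sqrt hT'.le
  have hC2 : √C ^ 2 = C := Real.sq_sqrt hC.le
  have hδ' : δ = √C / √T := by rw [hδ, Real.sqrt_div hC.le]
  have hδ0 : 0 < δ := by rw [hδ']; positivity
  have hm : √(T * C) = √T * √C := Real.sqrt_mul hT'.le _
  have hsν : 0 ≤ √ν := Real.sqrt_nonneg _
  have t1 : 4 * d * √(ν * T * Real.log (1 / δ)) ≤ 4 * √ν * l * (d * √T) := by
    have e : Real.log (1 / δ) ≤ Real.log (T / C) := by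
      refine Real.log_le_log (by positivity) ?_
      have h1 : 1 / δ = √(T / C) := by
        rw [hδ', Real.sqrt_div hT'.le, one_div_div]
      rw [h1]
      exact Real.sqrt_le_iff.2 ⟨by linarith, by nlinarith⟩
    have h1 : √(ν * T * Real.log (1 / δ)) ≤ √ν * √T * l := by
      rw [hl, ← Real.sqrt_mul hν.le, ← Real.sqrt_mul (by positivity)]
      exact Real.sqrt_le_sqrt (mul_le_mul_of_nonneg_left e (by positivity))
    calc _ ≤ 4 * d * (√ν * √T * l) := by gcongr
      _ = _ := by ring
  have t2 : 2 * C * d * (ν + 2 * √ν) * ((1 - δ) / δ) ≤ 4 * (ν + 2 * √ν) * l * (d * √(T * C)) := by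
    have h1 : (1 - δ) / δ ≤ √T / √C := by
      have : √T / √C = 1 / δ := by rw [hδ', one_div_div]
      rw [this]; gcongr; linarith
    calc _ ≤ 2 * C * d * (ν + 2 * √ν) * (√T / √C) := by gcongr
      _ = 2 * (ν + 2 * √ν) * (d * √(T * C)) := by
        rw [hm]; nth_rewrite 1 [← hC2]; field_simp
      _ = (4 * (ν + 2 * √ν) * (d * √(T * C))) * (1 / 2) := by ring
      _ ≤ (4 * (ν + 2 * √ν) * (d * √(T * C))) * l := by gcongr
      _ = _ := by ring
  have t3 : δ * G * D * T ≤ 2 * (G * D) * l * (d * √(T * C)) := by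
    have e : δ * G * D * T = G * D * √(T * C) := by
      have : √C / √T * T = √T * √C := by nth_rewrite 2 [← hT2]; field_simp
      rw [hm, hδ', ← this]; ring
    rw [e]
    have h1 : 1 ≤ 2 * l * d := by nlinarith
    calc _ ≤ G * D * √(T * C) * (2 * l * d) := le_mul_of_one_le_right (by positivity) h1
      _ = _ := by ring
  have t4 : 2 * C ≤ 4 * l * (d * C) := by
    have h1 : 1 ≤ 2 * l * d := by nlinarith
    calc _ ≤ 2 * C * (2 * l * d) := le_mul_of_one_le_right (by positivity) h1
      _ = _ := by ring
  have hl0 : 0 ≤ l := by linarith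
  have hGD : 0 ≤ G * D := by positivity
  calc _ ≤ 4 * √ν * l * (d * √T) + (4 * (ν + 2 * √ν) + 2 * (G * D)) * l * (d * √(T * C))
        + 4 * l * (d * C) := by linarith
    _ ≤ rateFactor ν G D * l * (d * √T) + rateFactor ν G D * l * (d * √(T * C))
        + rateFactor ν G D * l * (d * C) := by
      have h1 : 4 * √ν ≤ rateFactor ν G D := by unfold rateFactor; linarith
      have h2 : 4 * (ν + 2 * √ν) + 2 * (G * D) ≤ rateFactor ν G D := by
        unfold rateFactor; linarith
      have h3 : 4 ≤ rateFactor ν G D := by unfold rateFactor; linarith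
      gcongr
    _ = _ := by ring

theorem tuned_bound_zero {d T : ℕ} (hd : 0 < d) (hT : 2 ≤ T) {ν D G δ : ℝ} (hν : 0 < ν)
    (hG : 0 ≤ G) (hD : 0 ≤ D) (hδ : δ = 1 / (T : ℝ) ^ 2) :
    4 * d * √(ν * T * Real.log (1 / δ)) + δ * G * D * T ≤
      rateFactor ν G D * √(Real.log T) * (d * √T) := by
  have hT' : (2 : ℝ) ≤ T := by exact_mod_cast hT
  have hd' : (1 : ℝ) ≤ d := by exact_mod_cast hd
  have hl2 : 1 / 2 ≤ √(Real.log T) := half_le_sqrt_log_of_three_halves_le (by linarith)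
  have hsT : 1 ≤ √(T : ℝ) := Real.one_le_sqrt.2 (by linarith)
  have hlog : 0 ≤ Real.log T := Real.log_nonneg (by linarith)
  have e : Real.log (1 / δ) = 2 * Real.log T := by
    rw [hδ, one_div_one_div, Real.log_pow]; norm_num
  have t1 : 4 * d * √(ν * T * Real.log (1 / δ)) ≤ 8 * √ν * √(Real.log T) * (d * √T) := by
    have h1 : √(ν * T * Real.log (1 / δ)) ≤ 2 * (√ν * √T * √(Real.log T)) := by
      rw [e, ← Real.sqrt_mul hν.le, ← Real.sqrt_mul (by positivity)]
      refine Real.sqrt_le_iff.2 ⟨by positivity, ?_⟩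
      rw [mul_pow, Real.sq_sqrt (by positivity)]
      have : 0 ≤ ν * T * Real.log T := by positivity
      linarith
    calc _ ≤ 4 * d * (2 * (√ν * √T * √(Real.log T))) := by gcongr
      _ = _ := by ring
  have t2 : δ * G * D * T ≤ 2 * (G * D) * √(Real.log T) * (d * √T) := by
    have h1 : δ * T ≤ 1 := by
      rw [hδ, one_div_mul_eq_div, div_le_one (by positivity)]; nlinarith
    have h2 : 1 ≤ 2 * √(Real.log T) * (d * √T) := by
      have : 1 ≤ (d : ℝ) * √T := one_le_mul_of_one_le_of_one_le hd' hsT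
      nlinarith
    have hGD : 0 ≤ G * D := by positivity
    calc δ * G * D * T = G * D * (δ * T) := by ring
      _ ≤ G * D * (2 * √(Real.log T) * (d * √T)) :=
        mul_le_mul_of_nonneg_left (h1.trans h2) hGD
      _ = _ := by ring
  have hpos : 0 ≤ (4 * (ν + 2 * √ν) + 4) * √(Real.log T) * (d * √T) := by positivity
  unfold rateFactor
  linarith

theorem theorem1 :
    -- the regret bound, for every `δ ∈ (0, 1)`
    (∀ (d T : ℕ) (_ : 0 < d) (_ : 0 < T) (K : Set (Euc d)) (R : Euc d → ℝ) (ν D G C δ : ℝ)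
        (f : Fin T → Euc d → ℝ) (Ω : Type u) (_ : MeasurableSpace Ω) (P : Measure Ω)
        (_ : IsProbabilityMeasure P) (U : Fin T → Ω → Metric.sphere (0 : Euc d) 1)
        (x : Fin T → Ω → Euc d),
        IsActionSet K D → 0 < ν → IsSelfConcordantBarrier K R ν → IsLossSequence K G C f →
        0 < δ → δ < 1 →
        IsScribbleRun P K R (learningRate d T ν δ) δ f U x →
        (∀ t ω, scribblePlay R U x t ω ∈ K) ∧
        Integrable (fun ω => regret K f (fun t => scribblePlay R U x t ω)) P ∧
        ∫ ω, regret K f (fun t => scribblePlay R U x t ω) ∂P ≤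
          4 * d * √(ν * T * Real.log (1 / δ))
            + 2 * C * d * (ν + 2 * √ν) * ((1 - δ) / δ) + δ * G * D * T + 2 * C) ∧
    -- the rate for the tuned `δ`, with a factor `c` that depends on `ν`, `G`, `D` only
    (∃ c : ℝ → ℝ → ℝ → ℝ,
      ∀ (d T : ℕ) (_ : 0 < d) (_ : 0 < T) (K : Set (Euc d)) (R : Euc d → ℝ) (ν D G C δ : ℝ)
        (f : Fin T → Euc d → ℝ) (Ω : Type u) (_ : MeasurableSpace Ω) (P : Measure Ω)
        (_ : IsProbabilityMeasure P) (U : Fin T → Ω → Metric.sphere (0 : Euc d) 1)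
        (x : Fin T → Ω → Euc d),
        IsActionSet K D → 0 < ν → IsSelfConcordantBarrier K R ν → IsLossSequence K G C f →
        C / T ≤ 2 / 3 →
        IsScribbleRun P K R (learningRate d T ν δ) δ f U x →
        (C ≠ 0 → δ = √(C / T) →
          ∫ ω, regret K f (fun t => scribblePlay R U x t ω) ∂P ≤
            c ν G D * √(Real.log (T / C)) * (d * √T + d * √(T * C) + d * C)) ∧
        (C = 0 → 2 ≤ T → δ = 1 / (T : ℝ) ^ 2 →
          ∫ ω, regret K f (fun t => scribblePlay R U x t ω) ∂P ≤
            c ν G D * √(Real.log T) * (d * √T))) := by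
  refine ⟨?_, rateFactor, ?_⟩
  · intro d T hd hT K R ν D G C δ f Ω _ P _ U x hK hν hR hf hδ0 hδ1 h
    exact ⟨h.play_mem hK hR hδ0 hδ1, h.regret_bound hd hT hK hν hR hf hδ0 hδ1⟩
  · intro d T hd hT K R ν D G C δ f Ω _ P _ U x hK hν hR hf hCT h
    have hT' : (0 : ℝ) < T := by exact_mod_cast hT
    have hG := hf.slope_bound_nonneg hT
    have hD := hK.diam_nonneg
    constructor
    · intro hC0 hδ
      have hC : 0 < C := (hf.deviation_nonneg hK).lt_of_ne' hC0
      have hδ0 : 0 < δ := by rw [hδ]; positivity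
      have hδ1 : δ < 1 := by
        rw [hδ, Real.sqrt_lt' one_pos]; linarith
      exact (h.regret_bound hd hT hK hν hR hf hδ0 hδ1).2.trans
        (tuned_bound hd hT hν hG hD hC hCT hδ)
    · intro hC hT2 hδ
      have hT2' : (2 : ℝ) ≤ T := by exact_mod_cast hT2
      have hδ0 : 0 < δ := by rw [hδ]; positivity
      have hδ1 : δ < 1 := by
        rw [hδ, div_lt_one (by positivity)]; nlinarith
      have h1 := (h.regret_bound hd hT hK hν hR hf hδ0 hδ1).2
      have h2 := tuned_bound_zero hd hT2 hν hG hD hδ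
      rw [hC] at h1
      linarith
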